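/- Let $k$ be an algebraically closed field and let $A=\bigoplus_{i\in\mathbb N}A_i$ be a right noetherian connected graded $k$-algebra (connected means $A_0=k$). Let $G$ be a finite subgroup of the group $\operatorname{GrAut}A$ of graded $k$-algebra automorphisms of $A$ such that $\operatorname{char}k$ does not divide $|G|$. Let $A*G$ be the skew group algebra, that is, the $k$-space $A\otimes_k kG$ with multiplication $(a*g)(b*h)=a\,g(b)*gh$, graded by $(A*G)_i=A_i\otimes_k kG$; put $e=\frac1{|G|}\sum_{g\in G}1*g\in A*G$, and identify the invariant algebra $A^G$ with $e(A*G)e$ via $a\mapsto (a*1)e$. For an $\mathbb N$-graded right noetherian algebra $R$ let $\operatorname{grmod}R$ be the category of finitely presented $\mathbb Z$-graded right $R$-modules with homomorphisms of degree zero, let $\operatorname{tors}R$ be its full subcategory of torsion modules (those $M$ such that for every $m\in M$ there is $n\in\mathbb N$ with $mR_{\ge n}=0$), and let $\operatorname{tails}R=\operatorname{grmod}R/\operatorname{tors}R$ be the quotient category. The functor $M\mapsto Me$ from $\operatorname{grmod}A*G$ to $\operatorname{grmod}A^G$ preserves torsion modules and induces a functor $(-)e:\operatorname{tails}A*G\to\operatorname{tails}A^G$.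 Then the following are equivalent: 1. $A*G/(e)$ is finite dimensional over $k$, where $(e)$ is the two-sided ideal generated by $e$; 2. $(-)e:\operatorname{tails}A*G\to\operatorname{tails}A^G$ is an equivalence of categories. -/

import Mathlib

universe u v

namespace NCProj

open DirectSum MulOpposite CategoryTheory

/-! ### Graded right modules and the noncommutative projective scheme -/

section Tails

variable {k : Type v} {R : Type u} [Field k] [Ring R] [Algebra k R]

/-- A (`ℤ`-)graded right module over the `ℕ`-graded algebra `R = ⨁ 𝒜 i`.  Right `R`-modules are
`Rᵐᵒᵖ`-modules: `op a • m` is `m a`. -/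
structure GrMod (𝒜 : ℕ → Submodule k R) where
  carrier : Type u
  [addCommGroup : AddCommGroup carrier]
  [module : Module Rᵐᵒᵖ carrier]
  deg : ℤ → AddSubgroup carrier
  isInternal : DirectSum.IsInternal deg
  smul_mem : ∀ {i : ℕ} {j : ℤ} {a : R} {m : carrier},
    a ∈ 𝒜 i → m ∈ deg j → op a • m ∈ deg (j + i)

attribute [instance] GrMod.addCommGroup GrMod.module

variable {𝒜 : ℕ → Submodule k R}

/-- Morphisms of graded modules: right module homomorphisms of degree zero. -/
@[ext]
structure GrMod.Hom (M N : GrMod 𝒜) where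
  lin : M.carrier →ₗ[Rᵐᵒᵖ] N.carrier
  map_deg : ∀ (j : ℤ) (m : M.carrier), m ∈ M.deg j → lin m ∈ N.deg j

/-- The category `GrMod R` of graded right modules. -/
instance : Category (GrMod 𝒜) where
  Hom := GrMod.Hom
  id M := ⟨LinearMap.id, fun _ _ h => h⟩
  comp f g := ⟨g.lin ∘ₗ f.lin, fun j m h => g.map_deg j _ (f.map_deg j m h)⟩

variable (𝒜)

/-- The finitely presented graded right modules. -/
def finPres : ObjectProperty (GrMod 𝒜) := fun M => Module.FinitePresentation Rᵐᵒᵖ M.carrier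

/-- The category `grmod R` of finitely presented graded right modules. -/
abbrev grmod : Type (u + 1) := (finPres 𝒜).FullSubcategory

/-- A right module `M` is torsion if every `m : M` satisfies `m R_{≥ n} = 0` for some `n`. -/
def IsTorsion (M : Type u) [AddCommGroup M] [Module Rᵐᵒᵖ M] : Prop :=
  ∀ m : M, ∃ n : ℕ, ∀ i, n ≤ i → ∀ a ∈ 𝒜 i, op a • m = 0

/-- The morphisms of `grmod R` with torsion kernel and torsion cokernel. -/
def torsIso : MorphismProperty (grmod 𝒜) := fun _ N f =>
  IsTorsion 𝒜 (LinearMap.ker f.hom.lin) ∧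
    IsTorsion 𝒜 (N.obj.carrier ⧸ LinearMap.range f.hom.lin)

/-- The quotient category `tails R = grmod R / tors R` (for `R` right noetherian, so that `grmod R`
is abelian with the usual kernels and cokernels): the localization of `grmod R` at the morphisms
whose kernel and cokernel lie in `tors R`. -/
abbrev tails : Type (u + 1) := (torsIso 𝒜).Localization

end Tails

/-! ### Graded automorphisms, skew group algebras and invariants -/

section Basic

variable {k : Type v} {A : Type u} [Field k] [Ring A] [Algebra k A]

/-- `A = ⨁ 𝒜 i` is connected: `A_0 = k`. -/
def IsConnectedGraded (𝒜 : ℕ → Submodule k A) : Prop := Nontrivial A ∧ 𝒜 0 = 1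

/-- The group of graded `k`-algebra automorphisms of `A = ⨁ 𝒜 i`. -/
def GrAut (𝒜 : ℕ → Submodule k A) : Subgroup (A ≃ₐ[k] A) where
  carrier := {φ | ∀ i a, φ a ∈ 𝒜 i ↔ a ∈ 𝒜 i}
  mul_mem' := fun {φ ψ} hφ hψ i a => (hφ i (ψ a)).trans (hψ i a)
  one_mem' := fun _ _ => Iff.rfl
  inv_mem' := fun {φ} hφ i a => by
    rw [← hφ i (φ⁻¹ a), ← AlgEquiv.mul_apply, mul_inv_cancel, AlgEquiv.one_apply]

variable {𝒜 : ℕ → Submodule k A} (G : Subgroup (GrAut 𝒜))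

/-- The skew group algebra `A * G`, with `(a * g)(b * h) = a g(b) * gh`;
`SkewMonoidAlgebra.single g a` is `a * g`. -/
abbrev Skew : Type u := SkewMonoidAlgebra A G

/-- The invariant subalgebra `A^G`. -/
abbrev Inv : Subalgebra k A := FixedPoints.subalgebra k A G

/-- The grading of `A * G`, with `(A * G)_i = A_i * G`. -/
def skewGrading (i : ℕ) : Submodule k (Skew G) where
  carrier := {x | ∀ g, x.coeff g ∈ 𝒜 i}
  add_mem' := fun ha hb g => by
    simpa using add_mem (ha g) (hb g)
  zero_mem' := fun g => by simp
  smul_mem' := fun c x hx g => by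
    simpa using (𝒜 i).smul_mem c (hx g)

/-- The grading of `A^G`, with `(A^G)_i = A^G ∩ A_i`. -/
def invGrading (i : ℕ) : Submodule k (Inv G) := (𝒜 i).comap (Inv G).val.toLinearMap

/-- The inclusion `A^G ⊆ A ⊆ A * G`. -/
noncomputable def invToSkew : Inv G →+* Skew G :=
  SkewMonoidAlgebra.singleOneRingHom.comp (Inv G).val.toRingHom

/-- The element `e = |G|⁻¹ ∑ g` of `A * G`. -/
noncomputable def avg [Fintype G] : Skew G :=
  (Fintype.card G : k)⁻¹ • ∑ g : G, SkewMonoidAlgebra.single g 1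

/-- The averaging operator `a ↦ |G|⁻¹ ∑ g(a)` from `A` to `A^G`. -/
noncomputable def reynolds [Fintype G] (a : A) : Inv G :=
  ⟨(Fintype.card G : k)⁻¹ • ∑ g : G, g • a, fun h => by
    rw [smul_comm h, Finset.smul_sum]
    congr 1
    simp_rw [← mul_smul]
    exact Fintype.sum_equiv (Equiv.mulLeft h) _ _ (fun _ => rfl)⟩

lemma smul_mem_iff (g : G) (i : ℕ) (a : A) : g • a ∈ 𝒜 i ↔ a ∈ 𝒜 i := g.1.2 i a

lemma invToSkew_apply (a : Inv G) : invToSkew G a = SkewMonoidAlgebra.single 1 (a : A) := rfl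

lemma single_mul_avg [Fintype G] (g : G) (a : A) :
    SkewMonoidAlgebra.single g a * avg G = SkewMonoidAlgebra.single 1 a * avg G := by
  simp only [avg, mul_smul_comm, Finset.mul_sum, SkewMonoidAlgebra.single_mul_single, smul_one,
    mul_one, one_mul]
  congr 1
  exact Fintype.sum_equiv (Equiv.mulLeft g) _ _ (fun _ => rfl)

lemma avg_mul_single [Fintype G] (a : A) :
    avg G * SkewMonoidAlgebra.single 1 a * avg G = invToSkew G (reynolds G a) * avg G := by
  have h1 : avg G * SkewMonoidAlgebra.single 1 a =
      (Fintype.card G : k)⁻¹ • ∑ g : G, SkewMonoidAlgebra.single g (g • a) := by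
    simp only [avg, smul_mul_assoc, Finset.sum_mul, SkewMonoidAlgebra.single_mul_single, mul_one,
      one_mul]
  have h2 : invToSkew G (reynolds G a) =
      (Fintype.card G : k)⁻¹ • ∑ g : G, SkewMonoidAlgebra.single 1 (g • a) := by
    rw [invToSkew_apply, reynolds, ← SkewMonoidAlgebra.smul_single]
    congr 1
    exact map_sum (SkewMonoidAlgebra.singleAddHom (1 : G)) _ _
  rw [h1, h2, smul_mul_assoc, smul_mul_assoc, Finset.sum_mul, Finset.sum_mul]
  congr 1
  exact Finset.sum_congr rfl fun g _ => single_mul_avg G g _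

lemma avg_mul_avg [Fintype G] (hG : ¬ ringChar k ∣ Fintype.card G) :
    avg G * avg G = avg G := by
  have h0 : (Fintype.card G : k) ≠ 0 := fun h => hG ((ringChar.spec k _).1 h)
  conv_lhs => enter [1]; rw [avg]
  rw [smul_mul_assoc, Finset.sum_mul]
  simp_rw [single_mul_avg G _ (1 : A), SkewMonoidAlgebra.single_one_one, one_mul]
  rw [Finset.sum_const, Finset.card_univ, ← Nat.cast_smul_eq_nsmul k, smul_smul,
    inv_mul_cancel₀ h0, one_smul]

lemma avg_comm [Fintype G] (a : Inv G) : avg G * invToSkew G a = invToSkew G a * avg G := by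
  rw [avg, smul_mul_assoc, mul_smul_comm, Finset.sum_mul, Finset.mul_sum, invToSkew_apply]
  congr 1
  refine Finset.sum_congr rfl fun g _ => ?_
  rw [SkewMonoidAlgebra.single_mul_single, SkewMonoidAlgebra.single_mul_single, a.2 g]
  simp

lemma exists_avg_mul_avg [Fintype G] (s : Skew G) :
    ∃ a : Inv G, avg G * s * avg G = invToSkew G a * avg G := by
  refine SkewMonoidAlgebra.induction_on s ⟨0, by simp⟩ (fun g a => ?_) ?_
  · exact ⟨reynolds G a, by rw [mul_assoc, single_mul_avg, ← mul_assoc, avg_mul_single]⟩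
  · rintro x y ⟨a, ha⟩ ⟨b, hb⟩
    exact ⟨a + b, by rw [mul_add, add_mul, ha, hb, map_add, add_mul]⟩

lemma avg_mem [Fintype G] [GradedAlgebra 𝒜] : avg G ∈ skewGrading G 0 := by
  refine Submodule.smul_mem _ _ (Submodule.sum_mem _ fun g _ h => ?_)
  classical
  rw [SkewMonoidAlgebra.coeff_single_apply]
  split_ifs
  · exact SetLike.GradedOne.one_mem
  · exact zero_mem _

lemma invToSkew_mem {i : ℕ} {a : Inv G} (ha : a ∈ invGrading G i) :
    invToSkew G a ∈ skewGrading G i := fun g => by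
  classical
  rw [invToSkew_apply, SkewMonoidAlgebra.coeff_single_apply]
  split_ifs
  · exact ha
  · exact zero_mem _

/-! #### `A * G` and `A^G` are graded algebras -/

lemma isInternal_of_proj {ι N σ : Type*} [DecidableEq ι] [AddCommGroup N] [SetLike σ N]
    [AddSubmonoidClass σ N] (ℬ : ι → σ) (p : ι → N →+ N)
    (same : ∀ i, ∀ x ∈ ℬ i, p i x = x) (diff : ∀ i j, i ≠ j → ∀ x ∈ ℬ i, p j x = 0)
    (h : ∀ x, x ∈ AddSubmonoid.closure (⋃ i, (ℬ i : Set N))) : DirectSum.IsInternal ℬ := by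
  constructor
  · have key : ∀ (d : ⨁ i, ℬ i) (j : ι), p j (DirectSum.coeAddMonoidHom ℬ d) = d j := by
      intro d j
      induction d using DirectSum.induction_on with
      | zero => simp
      | of i x =>
        rw [DirectSum.coeAddMonoidHom_of]
        by_cases hij : i = j
        · subst hij
          rw [same _ _ x.2, DirectSum.of_eq_same]
        · rw [diff i j hij _ x.2, DirectSum.of_eq_of_ne _ _ _ (Ne.symm hij)]
          rfl
      | add x y hx hy => rw [map_add, map_add, hx, hy]; rfl
    intro d d' hd
    refine DFinsupp.ext fun j => Subtype.ext ?_
    rw [← key, ← key, hd]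
  · intro x
    have : AddSubmonoid.closure (⋃ i, (ℬ i : Set N)) ≤
        AddMonoidHom.mrange (DirectSum.coeAddMonoidHom ℬ) := by
      rw [AddSubmonoid.closure_le]
      rintro y hy
      obtain ⟨i, hi⟩ := Set.mem_iUnion.1 hy
      exact ⟨DirectSum.of (fun i => ℬ i) i ⟨y, hi⟩, DirectSum.coeAddMonoidHom_of _ _ _⟩
    exact this (h x)

lemma isInternal_range {N : Type*} [AddCommGroup N] (D : ℤ → AddSubgroup N)
    (hD : DirectSum.IsInternal D) (E : N →+ N) (hE : ∀ (j : ℤ), ∀ m ∈ D j, E m ∈ D j) :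
    DirectSum.IsInternal fun j => (D j).comap E.range.subtype := by
  classical
  let _ := hD.chooseDecomposition
  have hd : ∀ (j : ℤ) (m : N),
      (DirectSum.decompose D (E m) j : N) = E (DirectSum.decompose D m j : N) := by
    intro j m
    induction m using DirectSum.Decomposition.inductionOn D with
    | zero => simp
    | @homogeneous i m =>
      by_cases h : i = j
      · subst h
        rw [DirectSum.decompose_of_mem_same D m.2, DirectSum.decompose_of_mem_same D (hE _ _ m.2)]
      · rw [DirectSum.decompose_of_mem_ne D m.2 h,
          DirectSum.decompose_of_mem_ne D (hE _ _ m.2) h, map_zero]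
    | add a b ha hb =>
      simp only [map_add, DirectSum.decompose_add, DirectSum.add_apply, AddSubgroup.coe_add, ha, hb]
  let p : ℤ → E.range →+ E.range := fun j =>
    { toFun := fun m => ⟨DirectSum.decompose D (m : N) j, by
        obtain ⟨m', hm'⟩ := m.2
        exact ⟨DirectSum.decompose D m' j, by rw [← hm', hd]⟩⟩
      map_zero' := Subtype.ext (by simp)
      map_add' := fun _ _ => Subtype.ext (by simp) }
  refine isInternal_of_proj _ p ?_ ?_ ?_
  · exact fun i x hx => Subtype.ext (DirectSum.decompose_of_mem_same D hx)
  · exact fun i j hij x hx => Subtype.ext (DirectSum.decompose_of_mem_ne D hx hij)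
  · intro x
    have : x = ∑ i ∈ (DirectSum.decompose D (x : N)).support, p i x := by
      apply Subtype.ext
      rw [AddSubmonoidClass.coe_finsetSum]
      exact (DirectSum.sum_support_decompose D (x : N)).symm
    rw [this]
    exact sum_mem fun i _ => AddSubmonoid.subset_closure (Set.mem_iUnion.2 ⟨i,
      SetLike.coe_mem (DirectSum.decompose D (x : N) i)⟩)

instance [GradedAlgebra 𝒜] : SetLike.GradedMonoid (skewGrading G) where
  one_mem := fun g => by
    classical
    rw [SkewMonoidAlgebra.one_def, SkewMonoidAlgebra.coeff_single_apply]
    split_ifs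
    · exact SetLike.GradedOne.one_mem
    · exact zero_mem _
  mul_mem := fun i j x y hx hy => by
    rw [SkewMonoidAlgebra.mul_def, SkewMonoidAlgebra.sum_def']
    refine Submodule.sum_mem _ fun g _ => ?_
    rw [SkewMonoidAlgebra.sum_def']
    refine Submodule.sum_mem _ fun h _ l => ?_
    classical
    rw [SkewMonoidAlgebra.coeff_single_apply]
    split_ifs
    · exact SetLike.GradedMul.mul_mem (hx g) ((smul_mem_iff G g j _).2 (hy h))
    · exact zero_mem _

lemma skewGrading_isInternal [GradedAlgebra 𝒜] : DirectSum.IsInternal (skewGrading G) := by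
  classical
  refine isInternal_of_proj _ (fun i =>
    (SkewMonoidAlgebra.coeffAddEquiv.symm.toAddMonoidHom.comp
      ((Finsupp.mapRange.addMonoidHom (GradedRing.proj 𝒜 i)).comp
        SkewMonoidAlgebra.coeffAddEquiv.toAddMonoidHom))) ?_ ?_ ?_
  · intro i x hx
    refine SkewMonoidAlgebra.ext fun g => ?_
    exact DirectSum.decompose_of_mem_same 𝒜 (hx g)
  · intro i j hij x hx
    refine SkewMonoidAlgebra.ext fun g => ?_
    exact DirectSum.decompose_of_mem_ne 𝒜 (hx g) hij
  · intro x
    refine SkewMonoidAlgebra.induction_on x (zero_mem _) (fun g a => ?_)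
      (fun x y hx hy => add_mem hx hy)
    rw [← DirectSum.sum_support_decompose 𝒜 a]
    change SkewMonoidAlgebra.singleAddHom g _ ∈ _
    rw [_root_.map_sum]
    refine sum_mem fun i _ => AddSubmonoid.subset_closure (Set.mem_iUnion.2 ⟨i, fun h => ?_⟩)
    change (SkewMonoidAlgebra.single g _).coeff h ∈ _
    rw [SkewMonoidAlgebra.coeff_single_apply]
    split_ifs
    · exact SetLike.coe_mem _
    · exact zero_mem _

noncomputable instance [GradedAlgebra 𝒜] : GradedAlgebra (skewGrading G) where
  toDecomposition := (skewGrading_isInternal G).chooseDecomposition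

instance [GradedAlgebra 𝒜] : SetLike.GradedMonoid (invGrading G) where
  one_mem := SetLike.GradedOne.one_mem (A := 𝒜)
  mul_mem := fun _ _ _ _ hx hy => SetLike.GradedMul.mul_mem (A := 𝒜) hx hy

lemma decompose_smul [GradedAlgebra 𝒜] (g : G) (a : A) (i : ℕ) :
    g • (DirectSum.decompose 𝒜 a i : A) = DirectSum.decompose 𝒜 (g • a) i := by
  induction a using DirectSum.Decomposition.inductionOn 𝒜 with
  | zero => simp
  | @homogeneous j m =>
    by_cases h : j = i
    · subst h
      rw [DirectSum.decompose_of_mem_same 𝒜 m.2,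
        DirectSum.decompose_of_mem_same 𝒜 ((smul_mem_iff G g j _).2 m.2)]
    · rw [DirectSum.decompose_of_mem_ne 𝒜 m.2 h,
        DirectSum.decompose_of_mem_ne 𝒜 ((smul_mem_iff G g j _).2 m.2) h, smul_zero]
  | add a b ha hb =>
    simp only [DirectSum.decompose_add, DirectSum.add_apply, Submodule.coe_add, smul_add, ha, hb]

/-- The homogeneous components of an invariant are invariant. -/
noncomputable def invProj [GradedAlgebra 𝒜] (i : ℕ) : Inv G →+ Inv G where
  toFun a := ⟨GradedRing.proj 𝒜 i a, fun g => by
    change g • (DirectSum.decompose 𝒜 (a : A) i : A) = DirectSum.decompose 𝒜 (a : A) i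
    rw [decompose_smul, a.2 g]⟩
  map_zero' := Subtype.ext (map_zero _)
  map_add' _ _ := Subtype.ext (map_add _ _ _)

lemma invGrading_isInternal [GradedAlgebra 𝒜] : DirectSum.IsInternal (invGrading G) := by
  classical
  refine isInternal_of_proj _ (invProj G) ?_ ?_ ?_
  · exact fun i x hx => Subtype.ext (DirectSum.decompose_of_mem_same 𝒜 hx)
  · exact fun i j hij x hx => Subtype.ext (DirectSum.decompose_of_mem_ne 𝒜 hx hij)
  · intro x
    have : x = ∑ i ∈ (DirectSum.decompose 𝒜 (x : A)).support, invProj G i x := by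
      apply Subtype.ext
      rw [AddSubmonoidClass.coe_finsetSum]
      exact (DirectSum.sum_support_decompose 𝒜 (x : A)).symm
    rw [this]
    exact sum_mem fun i _ => AddSubmonoid.subset_closure (Set.mem_iUnion.2 ⟨i,
      SetLike.coe_mem (DirectSum.decompose 𝒜 (x : A) i)⟩)

noncomputable instance [GradedAlgebra 𝒜] : GradedAlgebra (invGrading G) where
  toDecomposition := (invGrading_isInternal G).chooseDecomposition

end Basic

/-! ### The functor `(-)e` -/

section Functor

variable {k : Type v} {A : Type u} [Field k] [Ring A] [Algebra k A]
  {𝒜 : ℕ → Submodule k A} (G : Subgroup (GrAut 𝒜)) [Fintype G]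

/-- The subgroup `M e` of a right `A * G`-module `M`. -/
noncomputable def mulE (M : Type u) [AddCommGroup M] [Module (Skew G)ᵐᵒᵖ M] : AddSubgroup M :=
  (DistribSMul.toAddMonoidHom M (op (avg G))).range

variable {G}

lemma mem_mulE {M : Type u} [AddCommGroup M] [Module (Skew G)ᵐᵒᵖ M] {m : M} :
    m ∈ mulE G M ↔ ∃ m', op (avg G) • m' = m := Iff.rfl

lemma avg_smul (hG : ¬ ringChar k ∣ Fintype.card G) {M : Type u} [AddCommGroup M]
    [Module (Skew G)ᵐᵒᵖ M] {m : M} (hm : m ∈ mulE G M) : op (avg G) • m = m := by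
  obtain ⟨m', rfl⟩ := mem_mulE.1 hm
  rw [← mul_smul, ← op_mul, avg_mul_avg G hG]

/-- `M e` is a right `A^G`-module through the isomorphism `A^G ≅ e(A * G)e`, `a ↦ e a e = a e`,
that is, by restriction of the action of `A * G` on `M` to `A^G`. -/
noncomputable instance (M : Type u) [AddCommGroup M] [Module (Skew G)ᵐᵒᵖ M] :
    Module (Inv G)ᵐᵒᵖ (mulE G M) where
  smul a m := ⟨op (invToSkew G a.unop) • (m : M), by
    obtain ⟨m', hm'⟩ := mem_mulE.1 m.2
    exact ⟨op (invToSkew G a.unop) • m', by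
      change op (avg G) • op (invToSkew G a.unop) • m' = _
      rw [← hm', ← mul_smul, ← mul_smul, ← op_mul, ← op_mul, avg_comm]⟩⟩
  one_smul m := Subtype.ext (by
    change op (invToSkew G 1) • (m : M) = m
    rw [map_one, op_one, one_smul])
  mul_smul a b m := Subtype.ext (by
    change op (invToSkew G (b.unop * a.unop)) • (m : M) =
      op (invToSkew G a.unop) • op (invToSkew G b.unop) • (m : M)
    rw [map_mul, op_mul, mul_smul])
  smul_zero a := Subtype.ext (smul_zero _)
  smul_add a m m' := Subtype.ext (smul_add _ _ _)
  add_smul a b m := Subtype.ext (by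
    change op (invToSkew G (a.unop + b.unop)) • (m : M) =
      op (invToSkew G a.unop) • (m : M) + op (invToSkew G b.unop) • (m : M)
    rw [map_add, MulOpposite.op_add, add_smul])
  zero_smul m := Subtype.ext (by
    change op (invToSkew G 0) • (m : M) = 0
    rw [map_zero, op_zero, zero_smul])

lemma coe_smul_mulE {M : Type u} [AddCommGroup M] [Module (Skew G)ᵐᵒᵖ M] (a : Inv G)
    (m : mulE G M) : ((op a • m : mulE G M) : M) = op (invToSkew G a) • (m : M) := rfl

/-- A linear map `M → N` restricts to `M e → N e`. -/
noncomputable def mulEMap {M N : Type u} [AddCommGroup M] [Module (Skew G)ᵐᵒᵖ M] [AddCommGroup N]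
    [Module (Skew G)ᵐᵒᵖ N] (f : M →ₗ[(Skew G)ᵐᵒᵖ] N) : mulE G M →ₗ[(Inv G)ᵐᵒᵖ] mulE G N where
  toFun m := ⟨f m, by
    obtain ⟨m', hm'⟩ := mem_mulE.1 m.2
    exact ⟨f m', by rw [← hm', map_smul]; rfl⟩⟩
  map_add' _ _ := Subtype.ext (map_add f _ _)
  map_smul' _ _ := Subtype.ext (map_smul f _ _)

lemma mulE_isInternal [GradedAlgebra 𝒜] (M : GrMod (skewGrading G)) :
    DirectSum.IsInternal fun j => (M.deg j).comap (mulE G M.carrier).subtype :=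
  isInternal_range M.deg M.isInternal _ fun j m hm => by
    simpa using M.smul_mem (avg_mem G) hm

variable (G) in
/-- The functor `(-)e : GrMod A * G ⥤ GrMod A^G`, with `(M e)_j = M e ∩ M_j`. -/
noncomputable def grModE [GradedAlgebra 𝒜] : GrMod (skewGrading G) ⥤ GrMod (invGrading G) where
  obj M :=
    { carrier := mulE G M.carrier
      deg := fun j => (M.deg j).comap (mulE G M.carrier).subtype
      isInternal := mulE_isInternal M
      smul_mem := fun ha hm => M.smul_mem (invToSkew_mem G ha) hm }
  map f := ⟨mulEMap f.lin, fun j m hm => f.map_deg j m hm⟩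

/-! #### `(-)e` preserves finitely presented modules -/

variable (G)

lemma isNoetherianRing_of_ringHom {R S : Type*} [Ring R] [Ring S] [IsNoetherianRing R] (φ : R →+* S)
    {s : Set S} (hs : s.Finite)
    (h : ∀ x, x ∈ AddSubmonoid.closure {y | ∃ r, ∃ t ∈ s, φ r * t = y}) : IsNoetherianRing S := by
  let _ : Module R S := Module.compHom S φ
  have : IsScalarTower R S S := ⟨fun a x y => mul_assoc (φ a) x y⟩
  have : Module.Finite R S := by
    refine ⟨Submodule.fg_def.2 ⟨s, hs, eq_top_iff.2 fun x _ => ?_⟩⟩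
    refine AddSubmonoid.closure_induction (motive := fun x _ => x ∈ Submodule.span R s) ?_
      (zero_mem _) (fun _ _ _ _ => add_mem) (h x)
    rintro _ ⟨r, t, ht, rfl⟩
    exact Submodule.smul_mem _ r (Submodule.subset_span ht)
  exact IsNoetherianRing.of_finite R S

lemma skew_isNoetherianRing [IsNoetherianRing Aᵐᵒᵖ] : IsNoetherianRing (Skew G)ᵐᵒᵖ := by
  refine isNoetherianRing_of_ringHom
    (RingHom.op SkewMonoidAlgebra.singleOneRingHom : Aᵐᵒᵖ →+* (Skew G)ᵐᵒᵖ)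
    (Set.finite_range fun g : G => op (SkewMonoidAlgebra.single g (1 : A))) fun x => ?_
  induction x using MulOpposite.rec' with
  | _ x =>
  refine SkewMonoidAlgebra.induction_on x (zero_mem _) (fun g a => ?_)
    (fun x y hx hy => add_mem hx hy)
  refine AddSubmonoid.subset_closure ⟨op (g⁻¹ • a), _, ⟨g, rfl⟩, ?_⟩
  apply unop_injective
  change SkewMonoidAlgebra.single g (1 : A) * SkewMonoidAlgebra.single 1 (g⁻¹ • a) = _
  rw [SkewMonoidAlgebra.single_mul_single]
  simp

lemma mulE_isNoetherian (hG : ¬ ringChar k ∣ Fintype.card G) (M : Type u) [AddCommGroup M]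
    [Module (Skew G)ᵐᵒᵖ M] [IsNoetherian (Skew G)ᵐᵒᵖ M] :
    IsNoetherian (Inv G)ᵐᵒᵖ (mulE G M) := by
  let S : Submodule (Inv G)ᵐᵒᵖ (mulE G M) → Submodule (Skew G)ᵐᵒᵖ M := fun N =>
    Submodule.span _ ((↑) '' (N : Set (mulE G M)))
  have key : ∀ (N : Submodule (Inv G)ᵐᵒᵖ (mulE G M)) (x : M), x ∈ S N →
      ∃ y ∈ N, (y : M) = op (avg G) • x := by
    intro N x hx
    refine Submodule.closure_induction (p := fun x _ => ∃ y ∈ N, (y : M) = op (avg G) • x)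
      ⟨0, zero_mem _, by simp⟩ ?_ ?_ hx
    · rintro x y - - ⟨x', hx', hx⟩ ⟨y', hy', hy⟩
      exact ⟨x' + y', add_mem hx' hy', by rw [smul_add, ← hx, ← hy]; rfl⟩
    · rintro r _ ⟨n, hn, rfl⟩
      obtain ⟨a, ha⟩ := exists_avg_mul_avg G r.unop
      refine ⟨op a • n, N.smul_mem _ hn, ?_⟩
      have hr : r = op r.unop := rfl
      rw [coe_smul_mulE]
      conv_lhs => rw [← avg_smul hG n.2]
      conv_rhs => rw [hr, ← avg_smul hG n.2]
      rw [← mul_smul, ← mul_smul, ← mul_smul, ← op_mul, ← op_mul, ← op_mul, ← mul_assoc, ha,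
        avg_comm]
  have hS : ∀ N N', S N ≤ S N' ↔ N ≤ N' := by
    intro N N'
    refine ⟨fun h x hx => ?_, fun h => Submodule.span_mono (Set.image_mono h)⟩
    obtain ⟨y, hy, hyx⟩ := key N' x (h (Submodule.subset_span ⟨x, hx, rfl⟩))
    rw [avg_smul hG x.2] at hyx
    rwa [← Subtype.ext hyx]
  have hinj : Function.Injective S := fun N N' h =>
    le_antisymm ((hS _ _).1 h.le) ((hS _ _).1 h.ge)
  let E : Submodule (Inv G)ᵐᵒᵖ (mulE G M) ↪o Submodule (Skew G)ᵐᵒᵖ M :=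
    ⟨⟨S, hinj⟩, fun {N N'} => hS N N'⟩
  exact isNoetherian_mk ⟨OrderEmbedding.wellFounded E.dual
    (isNoetherian_iff'.1 ‹IsNoetherian (Skew G)ᵐᵒᵖ M›).wf⟩

lemma inv_isNoetherianRing [IsNoetherianRing Aᵐᵒᵖ] (hG : ¬ ringChar k ∣ Fintype.card G) :
    IsNoetherianRing (Inv G)ᵐᵒᵖ := by
  have h0 : (Fintype.card G : k) ≠ 0 := fun h => hG ((ringChar.spec k _).1 h)
  have := skew_isNoetherianRing G
  have : Module.Finite (Skew G)ᵐᵒᵖ (Skew G) := by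
    refine ⟨Submodule.fg_def.2 ⟨{1}, Set.finite_singleton _, eq_top_iff.2 fun x _ => ?_⟩⟩
    exact Submodule.mem_span_singleton.2 ⟨op x, by simp⟩
  have := mulE_isNoetherian G hG (Skew G)
  let f : (Inv G)ᵐᵒᵖ →ₗ[(Inv G)ᵐᵒᵖ] mulE G (Skew G) :=
    LinearMap.toSpanSingleton _ _ ⟨avg G, mem_mulE.2 ⟨1, by simp⟩⟩
  refine isNoetherian_of_injective f ((injective_iff_map_eq_zero f).2 fun a ha => ?_)
  have h1 : avg G * invToSkew G a.unop = 0 := congrArg Subtype.val ha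
  have h2 := congrArg (fun x : Skew G => x.coeff 1) h1
  rw [avg_comm, invToSkew_apply] at h2
  have h3 : (avg G).coeff 1 = (Fintype.card G : k)⁻¹ • (1 : A) := by
    classical
    rw [avg, SkewMonoidAlgebra.coeff_smul, Finsupp.smul_apply]
    congr 1
    change ((SkewMonoidAlgebra.coeffAddEquiv (∑ g : G, SkewMonoidAlgebra.single g (1 : A))) 1) = 1
    rw [_root_.map_sum, Finsupp.finsetSum_apply]
    simp [SkewMonoidAlgebra.coeffAddEquiv, Finsupp.single_apply]
  simp only [SkewMonoidAlgebra.coeff_single_one_mul, h3] at h2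
  rw [mul_smul_comm, mul_one] at h2
  have h4 := (smul_eq_zero_iff_right (inv_ne_zero h0)).1 h2
  exact unop_injective (Subtype.ext h4)

variable {G} in
lemma grModE_finPres [GradedAlgebra 𝒜] [IsNoetherianRing Aᵐᵒᵖ]
    (hG : ¬ ringChar k ∣ Fintype.card G) (M : grmod (skewGrading G)) :
    finPres (invGrading G) ((grModE G).obj M.obj) := by
  have := skew_isNoetherianRing G
  have := inv_isNoetherianRing G hG
  have : Module.FinitePresentation (Skew G)ᵐᵒᵖ M.obj.carrier := M.property
  have := mulE_isNoetherian G hG M.obj.carrier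
  exact Module.finitePresentation_of_finite (Inv G)ᵐᵒᵖ (mulE G M.obj.carrier)

/-- The functor `(-)e : grmod A * G ⥤ grmod A^G`. -/
noncomputable def grmodE [GradedAlgebra 𝒜] [IsNoetherianRing Aᵐᵒᵖ]
    (hG : ¬ ringChar k ∣ Fintype.card G) :
    grmod (skewGrading G) ⥤ grmod (invGrading G) :=
  (finPres (invGrading G)).lift ((finPres (skewGrading G)).ι ⋙ grModE G)
    (grModE_finPres hG)

lemma isTorsion_ker_mulEMap {M N : Type u} [AddCommGroup M] [Module (Skew G)ᵐᵒᵖ M]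
    [AddCommGroup N] [Module (Skew G)ᵐᵒᵖ N] (f : M →ₗ[(Skew G)ᵐᵒᵖ] N)
    (hf : IsTorsion (skewGrading G) (LinearMap.ker f)) :
    IsTorsion (invGrading G) (LinearMap.ker (mulEMap f)) := by
  rintro ⟨x, hx⟩
  obtain ⟨n, hn⟩ := hf ⟨x.1, congrArg Subtype.val hx⟩
  refine ⟨n, fun i hi a ha => Subtype.ext (Subtype.ext ?_)⟩
  have h := congrArg Subtype.val (hn i hi _ (invToSkew_mem G ha))
  exact h

lemma isTorsion_coker_mulEMap (hG : ¬ ringChar k ∣ Fintype.card G) {M N : Type u} [AddCommGroup M]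
    [Module (Skew G)ᵐᵒᵖ M] [AddCommGroup N] [Module (Skew G)ᵐᵒᵖ N] (f : M →ₗ[(Skew G)ᵐᵒᵖ] N)
    (hf : IsTorsion (skewGrading G) (N ⧸ LinearMap.range f)) :
    IsTorsion (invGrading G) (mulE G N ⧸ LinearMap.range (mulEMap f)) := by
  intro y
  obtain ⟨y, rfl⟩ := Submodule.Quotient.mk_surjective _ y
  obtain ⟨n, hn⟩ := hf (Submodule.Quotient.mk y.1)
  refine ⟨n, fun i hi a ha => ?_⟩
  have h := hn i hi _ (invToSkew_mem G ha)
  rw [← Submodule.Quotient.mk_smul, Submodule.Quotient.mk_eq_zero] at h ⊢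
  obtain ⟨x, hx⟩ := h
  refine ⟨⟨op (avg G) • x, ⟨x, rfl⟩⟩, Subtype.ext ?_⟩
  change f (op (avg G) • x) = _
  rw [map_smul, hx]
  exact avg_smul hG (op a • y).2

lemma torsIso_grmodE [GradedAlgebra 𝒜] [IsNoetherianRing Aᵐᵒᵖ]
    (hG : ¬ ringChar k ∣ Fintype.card G) {M N : grmod (skewGrading G)} (f : M ⟶ N)
    (hf : torsIso (skewGrading G) f) : torsIso (invGrading G) ((grmodE G hG).map f) :=
  ⟨isTorsion_ker_mulEMap G f.hom.lin hf.1, isTorsion_coker_mulEMap G hG f.hom.lin hf.2⟩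

/-- The functor `(-)e : tails A * G ⥤ tails A^G` induced by `(-)e : grmod A * G ⥤ grmod A^G`. -/
noncomputable def tailsE [GradedAlgebra 𝒜] [IsNoetherianRing Aᵐᵒᵖ]
    (hG : ¬ ringChar k ∣ Fintype.card G) :
    tails (skewGrading G) ⥤ tails (invGrading G) :=
  Localization.Construction.lift (grmodE G hG ⋙ (torsIso (invGrading G)).Q)
    fun _ _ f hf => MorphismProperty.Q_inverts _ _ (torsIso_grmodE G hG f hf)

end Functor

end NCProj

namespace NCProj

open DirectSum MulOpposite CategoryTheory

/-! ### Homogeneous components of graded modules -/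

section Graded

variable {k : Type v} {R : Type u} [Field k] [Ring R] [Algebra k R] {𝒜 : ℕ → Submodule k R}

namespace GrMod

section Proj

variable (M : GrMod 𝒜)

/-- The projection of a graded module onto its component of degree `j`. -/
noncomputable def proj (j : ℤ) : M.carrier →+ M.carrier :=
  letI := M.isInternal.chooseDecomposition
  (M.deg j).subtype.comp ((DFinsupp.evalAddMonoidHom j).comp
    (decomposeAddEquiv M.deg).toAddMonoidHom)

variable {M}

lemma proj_mem (j : ℤ) (m : M.carrier) : M.proj j m ∈ M.deg j := SetLike.coe_mem _

lemma proj_of_mem {j : ℤ} {m : M.carrier} (h : m ∈ M.deg j) : M.proj j m = m :=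
  letI := M.isInternal.chooseDecomposition
  decompose_of_mem_same M.deg h

lemma proj_of_mem_ne {i j : ℤ} {m : M.carrier} (h : m ∈ M.deg i) (hij : i ≠ j) :
    M.proj j m = 0 :=
  letI := M.isInternal.chooseDecomposition
  decompose_of_mem_ne M.deg h hij

lemma exists_sum_proj (m : M.carrier) : ∃ s : Finset ℤ, m = ∑ i ∈ s, M.proj i m := by
  classical
  let _ := M.isInternal.chooseDecomposition
  exact ⟨_, (sum_support_decompose M.deg m).symm⟩

lemma mem_of_proj_mem {p : AddSubgroup M.carrier} {m : M.carrier} (h : ∀ j, M.proj j m ∈ p) :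
    m ∈ p := by
  obtain ⟨s, hs⟩ := exists_sum_proj m
  rw [hs]
  exact sum_mem fun i _ => h i

lemma homogeneous_induction {P : M.carrier → Prop} (m : M.carrier) (zero : P 0)
    (hom : ∀ j, ∀ m ∈ M.deg j, P m) (add : ∀ a b, P a → P b → P (a + b)) : P m := by
  obtain ⟨s, hs⟩ := exists_sum_proj m
  rw [hs]
  exact Finset.sum_induction _ P add zero fun i _ => hom i _ (proj_mem i m)

lemma proj_smul {i : ℕ} {a : R} (ha : a ∈ 𝒜 i) (j : ℤ) (m : M.carrier) :
    M.proj j (op a • m) = op a • M.proj (j - i) m := by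
  induction m using homogeneous_induction with
  | zero => simp
  | hom c m hm =>
    by_cases h : c + i = j
    · subst h
      rw [proj_of_mem (M.smul_mem ha hm), add_sub_cancel_right, proj_of_mem hm]
    · rw [proj_of_mem_ne (M.smul_mem ha hm) h, proj_of_mem_ne hm (by lia), smul_zero]
  | add x y hx hy => simp only [smul_add, map_add, hx, hy]

lemma Hom.map_proj {N : GrMod 𝒜} (f : GrMod.Hom M N) (j : ℤ) (m : M.carrier) :
    f.lin (M.proj j m) = N.proj j (f.lin m) := by
  induction m using homogeneous_induction with
  | zero => simp
  | hom c m hm =>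
    by_cases h : c = j
    · subst h
      rw [proj_of_mem hm, proj_of_mem (f.map_deg _ _ hm)]
    · rw [proj_of_mem_ne hm h, proj_of_mem_ne (f.map_deg _ _ hm) h, map_zero]
  | add x y hx hy => simp only [map_add, hx, hy]

end Proj

/-! ### Graded submodules, products and the regular module -/

section Constructions

variable (M : GrMod 𝒜)

/-- A homogeneous submodule of a graded module, as a graded module. -/
noncomputable def sub (p : Submodule Rᵐᵒᵖ M.carrier) (hp : ∀ j, ∀ m ∈ p, M.proj j m ∈ p) :
    GrMod 𝒜 where
  carrier := p
  deg j := (M.deg j).comap p.toAddSubgroup.subtype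
  isInternal := by
    let q : ℤ → p →+ p := fun j =>
      { toFun := fun m => ⟨M.proj j m, hp j m m.2⟩
        map_zero' := Subtype.ext (map_zero _)
        map_add' := fun _ _ => Subtype.ext (map_add _ _ _) }
    refine isInternal_of_proj _ q (fun i x hx => Subtype.ext (proj_of_mem hx))
      (fun i j hij x hx => Subtype.ext (proj_of_mem_ne hx hij)) fun x => ?_
    obtain ⟨s, hs⟩ := exists_sum_proj (x : M.carrier)
    have : x = ∑ i ∈ s, q i x := Subtype.ext (by
      rw [AddSubmonoidClass.coe_finsetSum]
      exact hs)
    rw [this]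
    exact sum_mem fun i _ => AddSubmonoid.subset_closure
      (Set.mem_iUnion.2 ⟨i, proj_mem i (x : M.carrier)⟩)
  smul_mem ha hm := M.smul_mem ha hm

/-- The inclusion of a homogeneous submodule. -/
noncomputable def subι (p : Submodule Rᵐᵒᵖ M.carrier) (hp : ∀ j, ∀ m ∈ p, M.proj j m ∈ p) :
    GrMod.Hom (M.sub p hp) M := ⟨p.subtype, fun _ _ h => h⟩

/-- The product of two graded modules. -/
noncomputable def prod (N : GrMod 𝒜) : GrMod 𝒜 where
  carrier := M.carrier × N.carrier
  deg j := (M.deg j).prod (N.deg j)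
  isInternal := by
    refine isInternal_of_proj _ (fun j => (M.proj j).prodMap (N.proj j))
      (fun i x hx => Prod.ext (proj_of_mem hx.1) (proj_of_mem hx.2))
      (fun i j hij x hx => Prod.ext (proj_of_mem_ne hx.1 hij) (proj_of_mem_ne hx.2 hij)) ?_
    rintro ⟨x, y⟩
    have hx : (x, 0) ∈ AddSubmonoid.closure
        (⋃ j, (((M.deg j).prod (N.deg j) : AddSubgroup (M.carrier × N.carrier)) :
          Set (M.carrier × N.carrier))) := by
      induction x using homogeneous_induction with
      | zero => exact zero_mem _
      | hom j x hx =>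
        exact AddSubmonoid.subset_closure (Set.mem_iUnion.2 ⟨j, hx, zero_mem _⟩)
      | add a b ha hb => simpa using add_mem ha hb
    have hy : (0, y) ∈ AddSubmonoid.closure
        (⋃ j, (((M.deg j).prod (N.deg j) : AddSubgroup (M.carrier × N.carrier)) :
          Set (M.carrier × N.carrier))) := by
      induction y using homogeneous_induction with
      | zero => exact zero_mem _
      | hom j y hy =>
        exact AddSubmonoid.subset_closure (Set.mem_iUnion.2 ⟨j, zero_mem _, hy⟩)
      | add a b ha hb => simpa using add_mem ha hb
    simpa using add_mem hx hy
  smul_mem ha hm := ⟨M.smul_mem ha hm.1, N.smul_mem ha hm.2⟩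

lemma prod_proj {M N : GrMod 𝒜} (j : ℤ) (m : (M.prod N).carrier) :
    (M.prod N).proj j m = (M.proj j m.1, N.proj j m.2) :=
  Prod.ext (Hom.map_proj (M := M.prod N) ⟨LinearMap.fst _ _ _, fun _ _ h => h.1⟩ j m)
    (Hom.map_proj (M := M.prod N) ⟨LinearMap.snd _ _ _, fun _ _ h => h.2⟩ j m)

variable (𝒜) in
/-- `R` as a graded right module over itself. -/
noncomputable def regular [GradedAlgebra 𝒜] : GrMod 𝒜 where
  carrier := R
  -- `Int.toNat` sends negative integers to 0, so without the case split `𝒜 0` would reappear in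
  -- every negative degree.
  deg j := if 0 ≤ j then (𝒜 j.toNat).toAddSubgroup else ⊥
  isInternal := by
    refine isInternal_of_proj _ (fun j => if 0 ≤ j then GradedRing.proj 𝒜 j.toNat else 0)
      (fun j x hx => ?_) (fun i j hij x hx => ?_) fun x => ?_
    · split_ifs at hx ⊢
      · exact decompose_of_mem_same 𝒜 hx
      · exact hx.symm
    · split_ifs at hx ⊢
      · exact decompose_of_mem_ne 𝒜 hx (by lia)
      · rw [AddSubgroup.mem_bot.1 hx, map_zero]
      · rfl
      · rfl
    · induction x using DirectSum.Decomposition.inductionOn 𝒜 with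
      | zero => exact zero_mem _
      | @homogeneous i m =>
        refine AddSubmonoid.subset_closure (Set.mem_iUnion.2 ⟨i, ?_⟩)
        rw [if_pos (Int.natCast_nonneg i)]
        exact m.2
      | add a b ha hb => exact add_mem ha hb
  smul_mem {i j a m} ha hm := by
    change m * a ∈ _
    split_ifs at hm with h
    · rw [if_pos (by lia), show (j + i).toNat = j.toNat + i by lia]
      exact SetLike.GradedMul.mul_mem (A := 𝒜) hm ha
    · rw [AddSubgroup.mem_bot.1 hm, zero_mul]
      exact zero_mem _

lemma mem_regular_deg [GradedAlgebra 𝒜] {i : ℕ} {a : R} : a ∈ (regular 𝒜).deg i ↔ a ∈ 𝒜 i :=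
  Iff.rfl

end Constructions

/-! ### Homogeneous submodules -/

section Homogeneous

variable {M N : GrMod 𝒜}

lemma Hom.proj_mem_ker (f : GrMod.Hom M N) (j : ℤ) (m : M.carrier)
    (hm : m ∈ LinearMap.ker f.lin) : M.proj j m ∈ LinearMap.ker f.lin := by
  rw [LinearMap.mem_ker] at hm ⊢
  rw [f.map_proj, hm, map_zero]

/-- If `p` contains all components of large degree, then the module is torsion modulo `p`. -/
lemma torsion_of_deg_le (p : AddSubgroup M.carrier) {d : ℤ} (h : ∀ j, d ≤ j → M.deg j ≤ p)
    (m : M.carrier) : ∃ n : ℕ, ∀ i, n ≤ i → ∀ a ∈ 𝒜 i, op a • m ∈ p := by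
  induction m using homogeneous_induction with
  | zero => exact ⟨0, fun _ _ _ _ => by simp⟩
  | hom j m hm =>
    exact ⟨(d - j).toNat, fun i hi a ha => h (j + i) (by lia) (M.smul_mem ha hm)⟩
  | add x y hx hy =>
    obtain ⟨n, hn⟩ := hx
    obtain ⟨n', hn'⟩ := hy
    refine ⟨max n n', fun i hi a ha => ?_⟩
    rw [smul_add]
    exact add_mem (hn i (by lia) a ha) (hn' i (by lia) a ha)

variable [GradedAlgebra 𝒜]

lemma proj_mem_span {s : Set M.carrier}
    (hs : ∀ j, ∀ m ∈ s, M.proj j m ∈ Submodule.span Rᵐᵒᵖ s) (j : ℤ) (m : M.carrier)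
    (hm : m ∈ Submodule.span Rᵐᵒᵖ s) : M.proj j m ∈ Submodule.span Rᵐᵒᵖ s := by
  induction hm using Submodule.closure_induction with
  | zero => simp
  | add x y _ _ hx hy => rw [map_add]; exact add_mem hx hy
  | smul_mem r x hx =>
    induction r using MulOpposite.rec' with
    | _ a =>
    induction a using DirectSum.Decomposition.inductionOn 𝒜 with
    | zero => simp
    | homogeneous a => rw [proj_smul a.2]; exact Submodule.smul_mem _ _ (hs _ _ hx)
    | add a b ha hb => rw [MulOpposite.op_add, add_smul, map_add]; exact add_mem ha hb

/-- Used for a graded `A^G`-module mapped into a graded `A * G`-module: hence `τ` is only additive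
and its source lives over another algebra `ℬ`. -/
lemma proj_mem_span_range {S : Type u} [Ring S] [Algebra k S] {ℬ : ℕ → Submodule k S}
    {T : GrMod ℬ} (τ : T.carrier →+ M.carrier) (hτ : ∀ j, ∀ t ∈ T.deg j, τ t ∈ M.deg j) (j : ℤ) :
    ∀ m ∈ Submodule.span Rᵐᵒᵖ (Set.range τ), M.proj j m ∈ Submodule.span Rᵐᵒᵖ (Set.range τ) := by
  refine proj_mem_span ?_ j
  rintro j _ ⟨t, rfl⟩
  induction t using homogeneous_induction with
  | zero => simp
  | add a b ha hb => rw [map_add, map_add]; exact add_mem ha hb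
  | hom i t ht =>
    by_cases hij : i = j
    · subst hij
      rw [proj_of_mem (hτ i t ht)]
      exact Submodule.subset_span ⟨t, rfl⟩
    · rw [proj_of_mem_ne (hτ i t ht) hij]
      exact zero_mem _

variable (M) in
/-- The submodule of elements with components in degrees `≥ d`. -/
noncomputable def trunc (d : ℤ) : Submodule Rᵐᵒᵖ M.carrier where
  carrier := {m | ∀ j < d, M.proj j m = 0}
  zero_mem' _ _ := map_zero _
  add_mem' hx hy j hj := by rw [map_add, hx j hj, hy j hj, add_zero]
  smul_mem' r x hx j hj := by
    induction r using MulOpposite.rec' with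
    | _ a =>
    induction a using DirectSum.Decomposition.inductionOn 𝒜 with
    | zero => simp
    | homogeneous a => rw [proj_smul a.2, hx _ (by lia), smul_zero]
    | add a b ha hb => rw [MulOpposite.op_add, add_smul, map_add, ha, hb, add_zero]

lemma mem_trunc_of_mem_deg {d j : ℤ} (h : d ≤ j) {m : M.carrier} (hm : m ∈ M.deg j) :
    m ∈ M.trunc d := fun i hi => proj_of_mem_ne hm (by lia)

lemma proj_mem_trunc (d j : ℤ) (m : M.carrier) (hm : m ∈ M.trunc d) : M.proj j m ∈ M.trunc d := by
  intro i hi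
  by_cases h : j = i
  · subst h
    rw [hm j hi, map_zero]
  · exact proj_of_mem_ne (proj_mem j m) h

/-- If a finitely generated graded module is torsion modulo `p`, then `p` contains all its
components of large degree. -/
lemma exists_deg_le_of_torsion [Module.Finite Rᵐᵒᵖ M.carrier] (p : AddSubgroup M.carrier)
    (h : ∀ m : M.carrier, ∃ n : ℕ, ∀ i, n ≤ i → ∀ a ∈ 𝒜 i, op a • m ∈ p) :
    ∃ d : ℤ, ∀ j, d ≤ j → M.deg j ≤ p := by
  have hspan : Submodule.span Rᵐᵒᵖ {m : M.carrier | ∃ j, m ∈ M.deg j} = ⊤ := by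
    refine eq_top_iff.2 fun m _ => ?_
    refine mem_of_proj_mem (p := (Submodule.span Rᵐᵒᵖ _).toAddSubgroup) fun j => ?_
    exact Submodule.subset_span ⟨j, proj_mem j m⟩
  obtain ⟨T, hT, hT'⟩ := (Submodule.fg_span_iff_fg_span_finset_subset _).1
    (hspan ▸ Module.Finite.fg_top)
  choose n hn using h
  choose! c hc using fun m (hm : m ∈ T) => hT hm
  -- The elements of `T` are homogeneous generators, `t` of degree `c t`. A product of `t` with an
  -- element of degree `i` can contribute to degree `j ≥ d` only if `c t + i = j`, which forces `i ≥
  -- n t`.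
  obtain ⟨d, hd⟩ := (T.image fun t => c t + n t).bddAbove
  refine ⟨d, fun j hj x hx => ?_⟩
  have hx' : x ∈ Submodule.span Rᵐᵒᵖ (T : Set M.carrier) := hT' ▸ hspan ▸ Submodule.mem_top
  rw [← proj_of_mem hx]
  clear hx
  induction hx' using Submodule.closure_induction with
  | zero => simp
  | add x y _ _ hx hy => rw [map_add]; exact add_mem hx hy
  | smul_mem r t ht =>
    induction r using MulOpposite.rec' with
    | _ a =>
    induction a using DirectSum.Decomposition.inductionOn 𝒜 with
    | zero => simp
    | @homogeneous i a =>
      by_cases hij : c t + i = j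
      · rw [← hij, proj_of_mem (M.smul_mem a.2 (hc t ht))]
        have : c t + n t ≤ d := hd (Finset.mem_coe.2 (Finset.mem_image_of_mem _ ht))
        exact hn t i (by lia) _ a.2
      · rw [proj_of_mem_ne (M.smul_mem a.2 (hc t ht)) hij]
        exact zero_mem _
    | add a b ha hb => rw [MulOpposite.op_add, add_smul, map_add]; exact add_mem ha hb

/-- The previous lemma applied to `q` as a graded module in its own right; `p` need not be contained
in `q`. -/
lemma exists_deg_inf_le_of_torsion (q : Submodule Rᵐᵒᵖ M.carrier) [Module.Finite Rᵐᵒᵖ q]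
    (hq : ∀ j, ∀ m ∈ q, M.proj j m ∈ q) (p : AddSubgroup M.carrier)
    (h : ∀ m ∈ q, ∃ n : ℕ, ∀ i, n ≤ i → ∀ a ∈ 𝒜 i, op a • m ∈ p) :
    ∃ d : ℤ, ∀ j, d ≤ j → ∀ m ∈ M.deg j, m ∈ q → m ∈ p := by
  have : Module.Finite Rᵐᵒᵖ (M.sub q hq).carrier := ‹_›
  obtain ⟨d, hd⟩ := exists_deg_le_of_torsion (M := M.sub q hq)
    (p.comap q.toAddSubgroup.subtype) fun m => h m.1 m.2
  exact ⟨d, fun j hj m hm hmq =>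
    hd j hj (show (⟨m, hmq⟩ : (M.sub q hq).carrier) ∈ (M.sub q hq).deg j from hm)⟩

end Homogeneous

end GrMod

end Graded

/-! ### Functors between localizations -/

section Localization

variable {C D C' D' : Type*} [Category* C] [Category* D] [Category* C'] [Category* D']
  {W : MorphismProperty C} {W' : MorphismProperty D} {F : C ⥤ D} {L : C ⥤ C'} {L' : D ⥤ D'}
  [L.IsLocalization W] {Ψ : C' ⥤ D'}

include W in
/-- A criterion for a functor to induce a faithful functor between localizations. -/
lemma faithful_of_localization [L'.IsLocalization W'] [W.HasRightCalculusOfFractions]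
    [W'.HasRightCalculusOfFractions] (e : F ⋙ L' ≅ L ⋙ Ψ)
    (heq : ∀ {X Y : C} (f g : X ⟶ Y) {T : D} (s : T ⟶ F.obj X), W' s →
      s ≫ F.map f = s ≫ F.map g → ∃ (X' : C) (t : X' ⟶ X), W t ∧ t ≫ f = t ≫ g) :
    Ψ.Faithful := by
  have := Localization.essSurj L W
  have key : ∀ {X Y : C} (φ ψ : L.obj X ⟶ L.obj Y), Ψ.map φ = Ψ.map ψ → φ = ψ := by
    intro X Y φ ψ h
    -- Clearing both denominators in turn reduces to two morphisms coming from `C`. Their images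
    -- under `F` then agree after a denominator in `W'`, which `heq` trades for one in `W`.
    obtain ⟨α, hα⟩ := Localization.exists_rightFraction L W φ
    have hα' : L.map α.s ≫ φ = L.map α.f := by
      rw [hα, MorphismProperty.RightFraction.map_s_comp_map]
    obtain ⟨β, hβ⟩ := Localization.exists_rightFraction L W (L.map α.s ≫ ψ)
    have hβ' : L.map β.s ≫ L.map α.s ≫ ψ = L.map β.f := by
      rw [hβ, MorphismProperty.RightFraction.map_s_comp_map]
    have := Localization.inverts L W α.s α.hs
    have := Localization.inverts L W β.s β.hs
    rw [← cancel_epi (L.map α.s), ← cancel_epi (L.map β.s), hα', hβ', ← L.map_comp]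
    have h1 : Ψ.map (L.map (β.s ≫ α.f)) = Ψ.map (L.map β.f) := by
      rw [L.map_comp, ← hα', ← hβ', Functor.map_comp, Functor.map_comp, Functor.map_comp,
        Functor.map_comp, h]
    have h2 : L'.map (F.map (β.s ≫ α.f)) = L'.map (F.map β.f) := by
      rw [← cancel_mono (e.hom.app Y)]
      exact (e.hom.naturality _).trans ((congrArg (e.hom.app _ ≫ ·) h1).trans
        (e.hom.naturality _).symm)
    obtain ⟨T, s, hs, hs'⟩ := (MorphismProperty.map_eq_iff_precomp L' W' _ _).1 h2
    obtain ⟨Z, t, ht, ht'⟩ := heq _ _ s hs hs'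
    exact (MorphismProperty.map_eq_iff_precomp L W _ _).2 ⟨Z, t, ht, ht'⟩
  refine ⟨fun {X Y} φ ψ h => ?_⟩
  have := key ((L.objObjPreimageIso X).hom ≫ φ ≫ (L.objObjPreimageIso Y).inv)
    ((L.objObjPreimageIso X).hom ≫ ψ ≫ (L.objObjPreimageIso Y).inv)
    (by simp only [Functor.map_comp, h])
  simpa using this

include W in
/-- A criterion for a functor to induce a full functor between localizations. -/
lemma full_of_localization [L'.IsLocalization W'] [W'.HasRightCalculusOfFractions]
    (e : F ⋙ L' ≅ L ⋙ Ψ)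
    (hfull : ∀ {X Y : C} {T : D} (s : T ⟶ F.obj X) (g : T ⟶ F.obj Y), W' s →
      ∃ (Z : C) (t : Z ⟶ X) (h : Z ⟶ Y) (τ : T ⟶ F.obj Z),
        W t ∧ W' τ ∧ τ ≫ F.map t = s ∧ τ ≫ F.map h = g) :
    Ψ.Full := by
  have := Localization.essSurj L W
  have key : ∀ {X Y : C} (φ : Ψ.obj (L.obj X) ⟶ Ψ.obj (L.obj Y)), ∃ ψ, Ψ.map ψ = φ := by
    intro X Y φ
    obtain ⟨α, hα⟩ := Localization.exists_rightFraction L' W' (e.hom.app X ≫ φ ≫ e.inv.app Y)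
    have hα' : L'.map α.s ≫ e.hom.app X ≫ φ ≫ e.inv.app Y = L'.map α.f := by
      rw [hα, MorphismProperty.RightFraction.map_s_comp_map]
    -- The roof representing `φ` is dominated by the image of a roof in `C`; as `τ` becomes
    -- invertible, it can be cancelled.
    obtain ⟨Z, t, h, τ, ht, hτ, hs, hg⟩ := hfull α.s α.f α.hs
    have := Localization.inverts L W t ht
    have := Localization.inverts L' W' τ hτ
    refine ⟨inv (L.map t) ≫ L.map h, ?_⟩
    have h1 : L'.map (F.map t) ≫ e.hom.app X ≫ φ ≫ e.inv.app Y = L'.map (F.map h) := by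
      rw [← cancel_epi (L'.map τ), ← Category.assoc, ← L'.map_comp, hs, hα', ← hg, L'.map_comp]
    have h2 : e.hom.app Z ≫ Ψ.map (L.map t) ≫ φ = e.hom.app Z ≫ Ψ.map (L.map h) := by
      have nt := e.hom.naturality t
      have nh := e.hom.naturality h
      simp only [Functor.comp_map] at nt nh
      rw [← nh, ← h1, ← Category.assoc, ← nt]
      simp
    rw [← cancel_epi (Ψ.map (L.map t)), ← Functor.map_comp, IsIso.hom_inv_id_assoc]
    exact ((cancel_epi _).1 h2).symm
  refine ⟨fun {X Y} φ => ?_⟩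
  obtain ⟨ψ, hψ⟩ := key (Ψ.map (L.objObjPreimageIso X).hom ≫ φ ≫
    Ψ.map (L.objObjPreimageIso Y).inv)
  exact ⟨(L.objObjPreimageIso X).inv ≫ ψ ≫ (L.objObjPreimageIso Y).hom, by
    simp [hψ]⟩

omit [L.IsLocalization W] in
/-- A criterion for a functor to induce an essentially surjective functor between localizations. -/
lemma essSurj_of_localization [L'.IsLocalization W'] (e : F ⋙ L' ≅ L ⋙ Ψ)
    (hsurj : ∀ Y : D, ∃ (X : C) (f : Y ⟶ F.obj X), W' f) : Ψ.EssSurj := by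
  have := Localization.essSurj L' W'
  refine ⟨fun Y => ?_⟩
  obtain ⟨X, f, hf⟩ := hsurj (L'.objPreimage Y)
  have := Localization.inverts L' W' f hf
  exact ⟨L.obj X, ⟨(e.app X).symm ≪≫ (asIso (L'.map f)).symm ≪≫ L'.objObjPreimageIso Y⟩⟩

/-- A morphism which becomes invertible in the localization is dominated by one in `W`. -/
lemma exists_comp_mem_of_isIso [W.HasRightCalculusOfFractions] {X Y : C} (f : X ⟶ Y)
    [IsIso (L.map f)] : ∃ (Z : C) (g : Z ⟶ X), W (g ≫ f) := by
  -- If the inverse is the fraction `α.f / α.s`, then `α.f ≫ f` and `α.s` agree in the localization,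
  -- hence after precomposition with some `s` in `W`.
  obtain ⟨α, hα⟩ := Localization.exists_rightFraction L W (inv (L.map f))
  have hα' : L.map α.s = L.map (α.f ≫ f) := by
    rw [L.map_comp, ← IsIso.comp_inv_eq, hα, MorphismProperty.RightFraction.map_s_comp_map]
  obtain ⟨Z, s, hs, hs'⟩ := (MorphismProperty.map_eq_iff_precomp L W _ _).1 hα'
  refine ⟨Z, s ≫ α.f, ?_⟩
  rw [Category.assoc, ← hs']
  exact W.comp_mem _ _ hs α.hs

end Localization

/-! ### Calculus of fractions for `grmod R` -/

section Fractions

variable {k : Type v} {R : Type u} [Field k] [Ring R] [Algebra k R] {𝒜 : ℕ → Submodule k R}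

lemma grmod_hom_ext {M N : grmod 𝒜} {f g : M ⟶ N} (h : ∀ m, f.hom.lin m = g.hom.lin m) : f = g :=
  ObjectProperty.hom_ext _ (GrMod.Hom.ext (LinearMap.ext h))

instance (M : grmod 𝒜) : Module.FinitePresentation Rᵐᵒᵖ M.obj.carrier := M.property

section Constructions

variable [IsNoetherianRing Rᵐᵒᵖ]

/-- A homogeneous submodule of an object of `grmod R`. -/
noncomputable def grmodSub (M : grmod 𝒜) (p : Submodule Rᵐᵒᵖ M.obj.carrier)
    (hp : ∀ j, ∀ m ∈ p, M.obj.proj j m ∈ p) : grmod 𝒜 :=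
  ⟨M.obj.sub p hp, Module.finitePresentation_of_finite Rᵐᵒᵖ p⟩

/-- The inclusion of a homogeneous submodule. -/
noncomputable def grmodSubι (M : grmod 𝒜) (p : Submodule Rᵐᵒᵖ M.obj.carrier)
    (hp : ∀ j, ∀ m ∈ p, M.obj.proj j m ∈ p) : grmodSub M p hp ⟶ M :=
  ObjectProperty.homMk (M.obj.subι p hp)

/-- The product of two objects of `grmod R`. -/
noncomputable def grmodProd (M N : grmod 𝒜) : grmod 𝒜 :=
  ⟨M.obj.prod N.obj,
    Module.finitePresentation_of_finite Rᵐᵒᵖ (M.obj.carrier × N.obj.carrier)⟩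

/-- The first projection. -/
noncomputable def grmodFst (M N : grmod 𝒜) : grmodProd M N ⟶ M :=
  ObjectProperty.homMk ⟨LinearMap.fst _ _ _, fun _ _ h => h.1⟩

/-- The second projection. -/
noncomputable def grmodSnd (M N : grmod 𝒜) : grmodProd M N ⟶ N :=
  ObjectProperty.homMk ⟨LinearMap.snd _ _ _, fun _ _ h => h.2⟩

end Constructions

variable [GradedAlgebra 𝒜]

/-- Over a right noetherian algebra, the kernel and cokernel of a morphism are torsion if and only
if it is bijective in all large degrees. -/
lemma torsIso_iff [IsNoetherianRing Rᵐᵒᵖ] {M N : grmod 𝒜} (f : M ⟶ N) :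
    torsIso 𝒜 f ↔ ∃ d : ℤ, ∀ j, d ≤ j → (∀ m ∈ M.obj.deg j, f.hom.lin m = 0 → m = 0) ∧
      ∀ y ∈ N.obj.deg j, ∃ m ∈ M.obj.deg j, f.hom.lin m = y := by
  constructor
  · rintro ⟨hker, hcoker⟩
    obtain ⟨d, hd⟩ := GrMod.exists_deg_inf_le_of_torsion (LinearMap.ker f.hom.lin)
      f.hom.proj_mem_ker ⊥ fun m hm => by
        obtain ⟨n, hn⟩ := hker ⟨m, hm⟩
        exact ⟨n, fun i hi a ha => congrArg Subtype.val (hn i hi a ha)⟩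
    obtain ⟨d', hd'⟩ := GrMod.exists_deg_le_of_torsion (M := N.obj)
      (LinearMap.range f.hom.lin).toAddSubgroup fun m => by
        obtain ⟨n, hn⟩ := hcoker (Submodule.Quotient.mk m)
        refine ⟨n, fun i hi a ha => ?_⟩
        have := hn i hi a ha
        rwa [← Submodule.Quotient.mk_smul, Submodule.Quotient.mk_eq_zero] at this
    refine ⟨max d d', fun j hj => ⟨fun m hm h => ?_, fun y hy => ?_⟩⟩
    · exact hd j (by lia) m hm h
    · obtain ⟨x, hx⟩ := hd' j (by lia) hy
      -- A preimage need not be homogeneous, but its component of degree `j` is again a preimage.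
      exact ⟨M.obj.proj j x, GrMod.proj_mem j x, by
        rw [f.hom.map_proj, hx, GrMod.proj_of_mem hy]⟩
  · rintro ⟨d, hd⟩
    constructor
    · refine GrMod.torsion_of_deg_le (M := M.obj.sub (LinearMap.ker f.hom.lin)
        f.hom.proj_mem_ker) ⊥ (d := d) fun j hj m hm => Subtype.ext ?_
      exact (hd j hj).1 _ hm m.2
    · intro y
      obtain ⟨y, rfl⟩ := Submodule.Quotient.mk_surjective _ y
      obtain ⟨n, hn⟩ := GrMod.torsion_of_deg_le (M := N.obj)
        (LinearMap.range f.hom.lin).toAddSubgroup (d := d) (fun j hj y hy => by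
          obtain ⟨x, -, hx⟩ := (hd j hj).2 y hy
          exact ⟨x, hx⟩) y
      refine ⟨n, fun i hi a ha => ?_⟩
      rw [← Submodule.Quotient.mk_smul, Submodule.Quotient.mk_eq_zero]
      exact hn i hi a ha

/-- Pullbacks and equalizers are homogeneous submodules, finitely presented by noetherianity, and
are computed degree by degree. So bijectivity in large degrees passes to pullbacks, and if `f ≫ s =
g ≫ s` with `s` injective in large degrees, the equalizer of `f` and `g` is everything there. -/
lemma torsIso_hasRightCalculusOfFractions [IsNoetherianRing Rᵐᵒᵖ] :
    (torsIso 𝒜).HasRightCalculusOfFractions where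
  id_mem M := (torsIso_iff _).2 ⟨0, fun j _ => ⟨fun m _ h => h, fun y hy => ⟨y, hy, rfl⟩⟩⟩
  comp_mem f g hf hg := by
    obtain ⟨d, hd⟩ := (torsIso_iff f).1 hf
    obtain ⟨d', hd'⟩ := (torsIso_iff g).1 hg
    refine (torsIso_iff _).2 ⟨max d d', fun j hj => ⟨fun m hm h => ?_, fun y hy => ?_⟩⟩
    · exact (hd j (by lia)).1 m hm ((hd' j (by lia)).1 _ (f.hom.map_deg j m hm) h)
    · obtain ⟨x, hx, rfl⟩ := (hd' j (by lia)).2 y hy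
      obtain ⟨z, hz, rfl⟩ := (hd j (by lia)).2 x hx
      exact ⟨z, hz, rfl⟩
  exists_rightFraction X Y φ := by
    let q : Submodule Rᵐᵒᵖ (grmodProd X Y).obj.carrier :=
      LinearMap.eqLocus (φ.f.hom.lin ∘ₗ LinearMap.fst _ _ _) (φ.s.hom.lin ∘ₗ LinearMap.snd _ _ _)
    have hq : ∀ z : X.obj.carrier × Y.obj.carrier,
      z ∈ q ↔ φ.f.hom.lin z.1 = φ.s.hom.lin z.2 := fun z => Iff.rfl
    let Z := grmodSub (grmodProd X Y) q fun j z hz => by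
      rw [show (grmodProd X Y).obj.proj j z = _ from GrMod.prod_proj j z]
      refine (hq _).2 ?_
      rw [φ.f.hom.map_proj, φ.s.hom.map_proj, (hq z).1 hz]
    let ι : Z ⟶ grmodProd X Y := grmodSubι _ _ _
    obtain ⟨d, hd⟩ := (torsIso_iff φ.s).1 φ.hs
    refine ⟨⟨ι ≫ grmodFst X Y, (torsIso_iff _).2 ⟨d, fun j hj =>
      ⟨fun z hz h => ?_, fun x hx => ?_⟩⟩, ι ≫ grmodSnd X Y⟩, grmod_hom_ext fun z => z.2⟩
    · have h1 : z.1.1 = 0 := h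
      have h2 : φ.f.hom.lin z.1.1 = φ.s.hom.lin z.1.2 := z.2
      rw [h1, map_zero] at h2
      exact Subtype.ext (Prod.ext h1 ((hd j hj).1 _ hz.2 h2.symm))
    · obtain ⟨y, hy, hxy⟩ := (hd j hj).2 _ (φ.f.hom.map_deg j x hx)
      exact ⟨⟨(x, y), hxy.symm⟩, ⟨hx, hy⟩, rfl⟩
  ext X Y Y' f g s hs h := by
    let q := LinearMap.eqLocus f.hom.lin g.hom.lin
    have hq : ∀ z, z ∈ q ↔ f.hom.lin z = g.hom.lin z := fun z => Iff.rfl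
    obtain ⟨d, hd⟩ := (torsIso_iff s).1 hs
    refine ⟨_, grmodSubι X q fun j z hz => ?_, (torsIso_iff _).2 ⟨d, fun j hj =>
      ⟨fun z _ h => Subtype.ext h, fun x hx => ⟨⟨x, ?_⟩, hx, rfl⟩⟩⟩, grmod_hom_ext fun z => z.2⟩
    · rw [hq, f.hom.map_proj, g.hom.map_proj, (hq z).1 hz]
    · rw [hq, ← sub_eq_zero]
      refine (hd j hj).1 _ (sub_mem (f.hom.map_deg j x hx) (g.hom.map_deg j x hx)) ?_
      rw [map_sub, sub_eq_zero]
      exact congrArg (fun φ => φ.hom.lin x) h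

end Fractions

/-! ### The projection of `A * G` onto `e(A * G)e = A^G` -/

section Corner

variable {k : Type v} {A : Type u} [Field k] [Ring A] [Algebra k A]
  {𝒜 : ℕ → Submodule k A} (G : Subgroup (GrAut 𝒜)) [Fintype G]

/-- The coefficient at the identity recovers `a` from `ae` up to a scalar, invertible under `hG`;
uniqueness of `corner` and its compatibility with degrees both rest on this. -/
lemma coeff_one_invToSkew_mul_avg (a : Inv G) :
    (invToSkew G a * avg G).coeff 1 = (Fintype.card G : k)⁻¹ • (a : A) := by
  classical
  have h : (avg G).coeff 1 = (Fintype.card G : k)⁻¹ • (1 : A) := by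
    rw [avg, SkewMonoidAlgebra.coeff_smul, Finsupp.smul_apply]
    congr 1
    change ((SkewMonoidAlgebra.coeffAddEquiv (∑ g : G, SkewMonoidAlgebra.single g (1 : A))) 1) = 1
    rw [_root_.map_sum, Finsupp.finsetSum_apply]
    simp [SkewMonoidAlgebra.coeffAddEquiv, Finsupp.single_apply]
  rw [invToSkew_apply]
  simp only [SkewMonoidAlgebra.coeff_single_one_mul, h]
  rw [mul_smul_comm, mul_one]

variable {G}

lemma card_ne_zero (hG : ¬ ringChar k ∣ Fintype.card G) : (Fintype.card G : k) ≠ 0 :=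
  fun h => hG ((ringChar.spec k _).1 h)

lemma invToSkew_mul_avg_injective (hG : ¬ ringChar k ∣ Fintype.card G) {a b : Inv G}
    (h : invToSkew G a * avg G = invToSkew G b * avg G) : a = b := by
  have h' := congrArg (fun x : Skew G => x.coeff 1) h
  simp only [coeff_one_invToSkew_mul_avg] at h'
  exact Subtype.ext (smul_right_injective A (inv_ne_zero (card_ne_zero hG)) h')

/-- The element `a` of `A^G` with `e x e = a e`. -/
noncomputable def corner (x : Skew G) : Inv G := (exists_avg_mul_avg G x).choose

lemma corner_spec (x : Skew G) : avg G * x * avg G = invToSkew G (corner x) * avg G :=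
  (exists_avg_mul_avg G x).choose_spec

/-- Although `corner` is a choice, uniqueness turns the identities for it into computations with
`exe` inside `A * G`. -/
lemma corner_eq (hG : ¬ ringChar k ∣ Fintype.card G) {x : Skew G} {a : Inv G}
    (h : avg G * x * avg G = invToSkew G a * avg G) : corner x = a :=
  invToSkew_mul_avg_injective hG ((corner_spec x).symm.trans h)

lemma corner_one (hG : ¬ ringChar k ∣ Fintype.card G) : corner (1 : Skew G) = 1 :=
  corner_eq hG (by rw [mul_one, map_one, one_mul, avg_mul_avg G hG])

lemma corner_add (hG : ¬ ringChar k ∣ Fintype.card G) (x y : Skew G) :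
    corner (x + y) = corner x + corner y :=
  corner_eq hG (by rw [mul_add, add_mul, corner_spec, corner_spec, map_add, add_mul])

lemma corner_invToSkew_mul (hG : ¬ ringChar k ∣ Fintype.card G) (a : Inv G) (x : Skew G) :
    corner (invToSkew G a * x) = a * corner x :=
  corner_eq hG (by
    rw [← mul_assoc, avg_comm, mul_assoc, mul_assoc, ← mul_assoc (avg G), corner_spec, map_mul,
      mul_assoc])

/-- Holds because `exe` times `ye` is `e(xey)e`; without the inserted `e`, multiplicativity fails in
general. -/
lemma corner_mul_avg_mul (hG : ¬ ringChar k ∣ Fintype.card G) (x y : Skew G) :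
    corner (x * (avg G * y)) = corner x * corner y :=
  corner_eq hG (by
    rw [map_mul, mul_assoc (invToSkew G _), ← corner_spec, ← mul_assoc (invToSkew G _),
      ← mul_assoc (invToSkew G _), ← corner_spec]
    simp only [mul_assoc])

lemma corner_mem [GradedAlgebra 𝒜] (hG : ¬ ringChar k ∣ Fintype.card G) {i : ℕ} {x : Skew G}
    (hx : x ∈ skewGrading G i) : corner x ∈ invGrading G i := by
  have h : avg G * x * avg G ∈ skewGrading G i := by
    have := SetLike.GradedMul.mul_mem (SetLike.GradedMul.mul_mem (avg_mem G) hx) (avg_mem G)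
    rwa [zero_add, add_zero] at this
  rw [corner_spec] at h
  have h1 := h 1
  rw [coeff_one_invToSkew_mul_avg] at h1
  have h2 := (𝒜 i).smul_mem (Fintype.card G : k) h1
  rwa [smul_smul, mul_inv_cancel₀ (card_ne_zero hG), one_smul] at h2

end Corner

/-! ### Extension of graded modules from `A^G` to `A * G` -/

section Extension

/-- The coinduced right `R`-module of an abelian group. -/
def Coind (R N : Type u) [Ring R] [AddCommGroup N] : Type u := R →+ N

noncomputable instance (R N : Type u) [Ring R] [AddCommGroup N] : AddCommGroup (Coind R N) :=
  inferInstanceAs (AddCommGroup (R →+ N))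

instance (R N : Type u) [Ring R] [AddCommGroup N] : FunLike (Coind R N) R N :=
  inferInstanceAs (FunLike (R →+ N) R N)

instance (R N : Type u) [Ring R] [AddCommGroup N] : AddMonoidHomClass (Coind R N) R N :=
  inferInstanceAs (AddMonoidHomClass (R →+ N) R N)

noncomputable instance (R N : Type u) [Ring R] [AddCommGroup N] : Module Rᵐᵒᵖ (Coind R N) where
  smul r f := AddMonoidHom.comp (f : R →+ N) (AddMonoidHom.mulLeft r.unop)
  one_smul f := DFunLike.ext _ _ fun x => congrArg f (one_mul x)
  mul_smul r s f := DFunLike.ext _ _ fun x => congrArg f (mul_assoc s.unop r.unop x)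
  smul_zero _ := rfl
  smul_add _ _ _ := rfl
  add_smul r s f := DFunLike.ext _ _ fun x =>
    (congrArg f (add_mul r.unop s.unop x)).trans (map_add f _ _)
  zero_smul f := DFunLike.ext _ _ fun x => (congrArg f (zero_mul x)).trans (map_zero f)

lemma Coind.smul_apply {R N : Type u} [Ring R] [AddCommGroup N] (r x : R) (f : Coind R N) :
    (op r • f) x = f (r * x) := rfl

lemma Coind.ext {R N : Type u} [Ring R] [AddCommGroup N] {f g : Coind R N}
    (h : ∀ x, f x = g x) : f = g := DFunLike.ext _ _ h

/-- Evaluation at an element. -/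
def Coind.eval {R N : Type u} [Ring R] [AddCommGroup N] (x : R) : Coind R N →+ N :=
  AddMonoidHom.eval x

/-- For submodules of a coinduced module no projections are at hand, but independence only needs
each nonzero homogeneous element to be detected by an additive map that kills all other components.
-/
lemma isInternal_of_separating {ι N N' : Type*} [DecidableEq ι] [AddCommGroup N]
    [AddCommGroup N'] (ℬ : ι → AddSubgroup N)
    (sep : ∀ i, ∀ x ∈ ℬ i, x ≠ 0 → ∃ q : N →+ N', q x ≠ 0 ∧ ∀ j, j ≠ i → ∀ y ∈ ℬ j, q y = 0)
    (h : ∀ x, x ∈ AddSubmonoid.closure (⋃ i, (ℬ i : Set N))) : DirectSum.IsInternal ℬ := by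
  constructor
  · have key : ∀ (q : N →+ N') (i : ι), (∀ j, j ≠ i → ∀ y ∈ ℬ j, q y = 0) →
        ∀ d : ⨁ i, ℬ i, q (DirectSum.coeAddMonoidHom ℬ d) = q (d i) := by
      intro q i hq d
      induction d using DirectSum.induction_on with
      | zero => simp
      | of j x =>
        rw [DirectSum.coeAddMonoidHom_of]
        by_cases hij : j = i
        · subst hij
          rw [DirectSum.of_eq_same]
        · rw [hq j hij _ x.2, DirectSum.of_eq_of_ne _ _ _ (Ne.symm hij)]
          exact (map_zero q).symm
      | add x y hx hy => rw [map_add, map_add, hx, hy, ← map_add]; rfl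
    refine (injective_iff_map_eq_zero _).2 fun d hd => DFinsupp.ext fun i => Subtype.ext ?_
    by_contra hi
    obtain ⟨q, hq, hq'⟩ := sep i _ (d i).2 hi
    rw [← key q i hq', hd, map_zero] at hq
    exact hq rfl
  · intro x
    have : AddSubmonoid.closure (⋃ i, (ℬ i : Set N)) ≤
        AddMonoidHom.mrange (DirectSum.coeAddMonoidHom ℬ) := by
      rw [AddSubmonoid.closure_le]
      rintro y hy
      obtain ⟨i, hi⟩ := Set.mem_iUnion.1 hy
      exact ⟨DirectSum.of (fun i => ℬ i) i ⟨y, hi⟩, DirectSum.coeAddMonoidHom_of _ _ _⟩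
    exact this (h x)

variable {k : Type v} {A : Type u} [Field k] [Ring A] [Algebra k A]
  {𝒜 : ℕ → Submodule k A} {G : Subgroup (GrAut 𝒜)} [Fintype G]
  (hG : ¬ ringChar k ∣ Fintype.card G)

/-- The map `n ↦ (x ↦ n (e x e))` from a right `A^G`-module `N` to the coinduced module. -/
noncomputable def toCoind (N : Type u) [AddCommGroup N] [Module (Inv G)ᵐᵒᵖ N] :
    N →+ Coind (Skew G) N where
  toFun n := ({
    toFun := fun x => op (corner x) • n
    map_zero' := by
      have := corner_add hG 0 0
      rw [add_zero, left_eq_add] at this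
      rw [this, op_zero, zero_smul]
    map_add' := fun x y => by rw [corner_add hG, MulOpposite.op_add, add_smul] } : Skew G →+ N)
  map_zero' := Coind.ext fun x => smul_zero _
  map_add' m n := Coind.ext fun x => smul_add _ _ _

section

variable {N : Type u} [AddCommGroup N] [Module (Inv G)ᵐᵒᵖ N]

lemma toCoind_apply (n : N) (x : Skew G) : toCoind hG N n x = op (corner x) • n := rfl

lemma toCoind_injective : Function.Injective (toCoind hG N) := fun m n h => by
  have := DFunLike.congr_fun h (1 : Skew G)
  simpa [toCoind_apply, corner_one hG] using this

lemma toCoind_smul (a : Inv G) (n : N) :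
    toCoind hG N (op a • n) = op (invToSkew G a) • toCoind hG N n := Coind.ext fun x => by
  rw [Coind.smul_apply, toCoind_apply, toCoind_apply, corner_invToSkew_mul hG, op_mul, mul_smul]

/-- The key to `Me = N`: multiplication by `e` carries `N r` back into `N`, since `corner` is
multiplicative across an inserted `e`. -/
lemma avg_smul_smul_toCoind (r : Skew G) (n : N) :
    op (avg G) • op r • toCoind hG N n = toCoind hG N (op (corner r) • n) := Coind.ext fun x => by
  rw [Coind.smul_apply, Coind.smul_apply, toCoind_apply, toCoind_apply, corner_mul_avg_mul hG,
    op_mul, mul_smul]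

lemma avg_smul_toCoind (n : N) : op (avg G) • toCoind hG N n = toCoind hG N n := by
  simpa [corner_one hG] using avg_smul_smul_toCoind hG 1 n

variable (N) in
/-- The `A * G`-submodule of the coinduced module generated by `N`. -/
noncomputable def extension : Submodule (Skew G)ᵐᵒᵖ (Coind (Skew G) N) :=
  Submodule.span _ (Set.range (toCoind hG N))

/-- The map from `N` to the submodule generated by it. -/
noncomputable def toExtension : N →+ extension hG N :=
  (toCoind hG N).codRestrict _ fun n => Submodule.subset_span ⟨n, rfl⟩

lemma extension_induction {P : extension hG N → Prop} (f : extension hG N) (zero : P 0)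
    (smul : ∀ (r : Skew G) (n : N), P (op r • toExtension hG n))
    (add : ∀ f g, P f → P g → P (f + g)) : P f := by
  obtain ⟨f, hf⟩ := f
  refine Submodule.closure_induction (p := fun f hf => P ⟨f, hf⟩) zero
    (fun x y hx hy h h' => add _ _ h h') ?_ hf
  rintro r _ ⟨n, rfl⟩
  exact smul r.unop n

lemma exists_toExtension_eq_avg_smul (f : extension hG N) :
    ∃ n, toExtension hG n = op (avg G) • f := by
  induction f using extension_induction with
  | zero => exact ⟨0, by rw [map_zero, smul_zero]⟩
  | add f g hf hg =>
    obtain ⟨m, hm⟩ := hf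
    obtain ⟨n, hn⟩ := hg
    exact ⟨m + n, by rw [map_add, smul_add, hm, hn]⟩
  | smul r n => exact ⟨op (corner r) • n, Subtype.ext (avg_smul_smul_toCoind hG r n).symm⟩

lemma extension_finite [Module.Finite (Inv G)ᵐᵒᵖ N] :
    Module.Finite (Skew G)ᵐᵒᵖ (extension hG N) := by
  obtain ⟨s, hs⟩ := (Module.Finite.fg_top : (⊤ : Submodule (Inv G)ᵐᵒᵖ N).FG)
  classical
  refine ⟨⟨s.image (toExtension hG), eq_top_iff.2 fun f _ => ?_⟩⟩
  induction f using extension_induction with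
  | zero => exact zero_mem _
  | add f g hf hg => exact add_mem (hf trivial) (hg trivial)
  | smul r n =>
    refine Submodule.smul_mem _ _ ?_
    clear * - hs
    have hn : n ∈ Submodule.span (Inv G)ᵐᵒᵖ (s : Set N) := hs ▸ Submodule.mem_top
    induction hn using Submodule.closure_induction with
    | zero => rw [map_zero]; exact zero_mem _
    | add x y _ _ hx hy => rw [map_add]; exact add_mem hx hy
    | smul_mem a x hx =>
      have : toExtension hG (a • x) = op (invToSkew G a.unop) • toExtension hG x :=
        Subtype.ext (toCoind_smul hG a.unop x)
      rw [this]
      exact Submodule.smul_mem _ _ (Submodule.subset_span (by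
        rw [Finset.coe_image]; exact ⟨x, hx, rfl⟩))

end

variable [GradedAlgebra 𝒜]

/-- The components of the extension of a graded module. -/
noncomputable def extensionDeg (N : GrMod (invGrading G)) (j : ℤ) :
    AddSubgroup (extension hG N.carrier) where
  carrier := {f | ∀ (i : ℕ), ∀ x ∈ skewGrading G i, f.1 x ∈ N.deg (j + i)}
  zero_mem' _ _ _ := zero_mem _
  add_mem' hf hg i x hx := add_mem (hf i x hx) (hg i x hx)
  neg_mem' hf i x hx := neg_mem (hf i x hx)

lemma smul_mem_extensionDeg (N : GrMod (invGrading G)) {i : ℕ} {j : ℤ} {a : Skew G}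
    {f : extension hG N.carrier} (ha : a ∈ skewGrading G i) (hf : f ∈ extensionDeg hG N j) :
    op a • f ∈ extensionDeg hG N (j + i) := fun i' x hx => by
  have := hf (i + i') (a * x) (SetLike.GradedMul.mul_mem ha hx)
  rwa [Nat.cast_add, ← add_assoc] at this

lemma toExtension_mem {N : GrMod (invGrading G)} {j : ℤ} {n : N.carrier} (hn : n ∈ N.deg j) :
    toExtension hG n ∈ extensionDeg hG N j := fun _ _ hx => N.smul_mem (corner_mem hG hx) hn

lemma extension_isInternal (N : GrMod (invGrading G)) :
    DirectSum.IsInternal (extensionDeg hG N) := by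
  refine isInternal_of_separating (N' := N.carrier) _ (fun j f hf hf0 => ?_) fun f => ?_
  · have : ∃ (i : ℕ), ∃ x ∈ skewGrading G i, f.1 x ≠ 0 := by
      by_contra! h
      refine hf0 (Subtype.ext (Coind.ext fun x => ?_))
      change f.1 x = 0
      induction x using DirectSum.Decomposition.inductionOn (skewGrading G) with
      | zero => exact map_zero f.1
      | homogeneous x => exact h _ _ x.2
      | add x y hx hy => rw [map_add, hx, hy, add_zero]
    obtain ⟨i, x, hx, hfx⟩ := this
    -- The detecting map evaluates at a homogeneous `x` of degree `i` with `f x ≠ 0`, then projects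
    -- to degree `j + i`; elements of another degree `j'` take values in degree `j' + i`.
    refine ⟨(N.proj (j + i)).comp ((Coind.eval x).comp
      (extension hG N.carrier).toAddSubgroup.subtype), ?_, fun j' hj' g hg => ?_⟩
    · change N.proj (j + i) (f.1 x) ≠ 0
      rwa [GrMod.proj_of_mem (hf i x hx)]
    · exact GrMod.proj_of_mem_ne (hg i x hx) (by lia)
  · induction f using extension_induction with
    | zero => exact zero_mem _
    | add f g hf hg => exact add_mem hf hg
    | smul r n =>
      induction n using GrMod.homogeneous_induction with
      | zero => rw [map_zero, smul_zero]; exact zero_mem _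
      | add m n hm hn => rw [map_add, smul_add]; exact add_mem hm hn
      | hom j n hn =>
        induction r using DirectSum.Decomposition.inductionOn (skewGrading G) with
        | zero => rw [op_zero, zero_smul]; exact zero_mem _
        | add x y hx hy => rw [MulOpposite.op_add, add_smul]; exact add_mem hx hy
        | @homogeneous i x =>
          exact AddSubmonoid.subset_closure (Set.mem_iUnion.2 ⟨j + i,
            smul_mem_extensionDeg hG N x.2 (toExtension_mem hG hn)⟩)

/-- The graded `A * G`-module generated by a graded `A^G`-module. -/
noncomputable def grExtension (N : GrMod (invGrading G)) : GrMod (skewGrading G) where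
  carrier := extension hG N.carrier
  deg := extensionDeg hG N
  isInternal := extension_isInternal hG N
  smul_mem := smul_mem_extensionDeg hG N

lemma toExtension_mem_mulE {N : GrMod (invGrading G)} (n : N.carrier) :
    toExtension hG n ∈ mulE G (grExtension hG N).carrier :=
  ⟨(toExtension hG n : extension hG N.carrier), Subtype.ext (avg_smul_toCoind hG n)⟩

/-- The map from `N` to `M e`, where `M` is the `A * G`-module generated by `N`. -/
noncomputable def unitExtension (N : GrMod (invGrading G)) :
    N ⟶ (grModE G).obj (grExtension hG N) where
  lin :=
    { toFun := fun n => ⟨toExtension hG n, toExtension_mem_mulE hG n⟩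
      map_add' := fun m n => Subtype.ext (map_add (toExtension hG) m n)
      map_smul' := fun a n => Subtype.ext (Subtype.ext (toCoind_smul hG a.unop n)) }
  map_deg _ _ hn := toExtension_mem hG hn

lemma unitExtension_bijective (N : GrMod (invGrading G)) :
    Function.Bijective (unitExtension hG N).lin := by
  constructor
  · intro m n h
    exact toCoind_injective hG (congrArg (fun z => z.1.1) h)
  · rintro ⟨f, g, rfl⟩
    obtain ⟨n, hn⟩ := exists_toExtension_eq_avg_smul hG g
    exact ⟨n, Subtype.ext hn⟩

end Extension

/-! ### The ideal `(e)` -/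

section Ideal

variable {k : Type v} {R : Type u} [Field k] [Ring R] [Algebra k R] {𝒜 : ℕ → Submodule k R}

lemma finite_op_self (R : Type u) [Ring R] : Module.Finite Rᵐᵒᵖ R :=
  ⟨Submodule.fg_def.2 ⟨{1}, Set.finite_singleton _, eq_top_iff.2 fun x _ =>
    Submodule.mem_span_singleton.2 ⟨op x, by simp⟩⟩⟩

lemma span_singleton_induction {e : R} {P : R → Prop} {x : R}
    (hx : x ∈ TwoSidedIdeal.span {e}) (zero : P 0) (mul : ∀ a b, P (a * e * b))
    (add : ∀ x y, P x → P y → P (x + y)) (neg : ∀ x, P x → P (-x)) : P x := by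
  rw [TwoSidedIdeal.mem_span_iff_mem_addSubgroup_closure] at hx
  induction hx using AddSubgroup.closure_induction with
  | zero => exact zero
  | add x y _ _ hx hy => exact add x y hx hy
  | neg x _ hx => exact neg x hx
  | mem x hx =>
    obtain ⟨_, ⟨a, -, _, rfl, rfl⟩, b, -, rfl⟩ := hx
    exact mul a b

/-- A two-sided ideal as a right submodule. -/
def rightIdeal (I : TwoSidedIdeal R) : Submodule Rᵐᵒᵖ R where
  carrier := {x | x ∈ I}
  zero_mem' := I.zero_mem
  add_mem' := I.add_mem
  smul_mem' r x hx := I.mul_mem_right x r.unop hx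

variable [GradedAlgebra 𝒜]

variable (𝒜) in
/-- The projection of `R` onto its component of degree `j : ℤ`. -/
noncomputable def intProj (j : ℤ) : R →+ R := (GrMod.regular 𝒜).proj j

lemma intProj_of_mem {i : ℕ} {x : R} (hx : x ∈ 𝒜 i) : intProj 𝒜 i x = x :=
  GrMod.proj_of_mem ((GrMod.mem_regular_deg (R := R)).2 hx)

lemma intProj_of_mem_ne {i : ℕ} {j : ℤ} {x : R} (hx : x ∈ 𝒜 i) (hij : (i : ℤ) ≠ j) :
    intProj 𝒜 j x = 0 :=
  GrMod.proj_of_mem_ne ((GrMod.mem_regular_deg (R := R)).2 hx) hij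

lemma intProj_mul {i : ℕ} {a : R} (ha : a ∈ 𝒜 i) (j : ℤ) (x : R) :
    intProj 𝒜 j (x * a) = intProj 𝒜 (j - i) x * a :=
  GrMod.proj_smul (M := GrMod.regular 𝒜) ha j x

/-- As `e` has degree 0, `(e)` is additively generated by the homogeneous elements `aeb` with `a`
and `b` homogeneous. -/
lemma intProj_mem_span_singleton {e : R} (he : e ∈ 𝒜 0) (j : ℤ) (x : R)
    (hx : x ∈ TwoSidedIdeal.span {e}) : intProj 𝒜 j x ∈ TwoSidedIdeal.span {e} := by
  refine span_singleton_induction (P := fun x => intProj 𝒜 j x ∈ TwoSidedIdeal.span {e}) hx ?_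
    (fun a b => ?_) (fun x y hx hy => ?_) fun x hx => ?_
  · rw [map_zero]; exact zero_mem _
  · induction a using DirectSum.Decomposition.inductionOn 𝒜 with
    | zero => rw [zero_mul, zero_mul, map_zero]; exact zero_mem _
    | add x y hx hy => rw [add_mul, add_mul, map_add]; exact add_mem hx hy
    | @homogeneous p a =>
      induction b using DirectSum.Decomposition.inductionOn 𝒜 with
      | zero => rw [mul_zero, map_zero]; exact zero_mem _
      | add x y hx hy => rw [mul_add, map_add]; exact add_mem hx hy
      | @homogeneous q b =>
        have h : (a : R) * e * b ∈ 𝒜 (p + 0 + q) :=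
          SetLike.GradedMul.mul_mem (SetLike.GradedMul.mul_mem a.2 he) b.2
        by_cases hj : ((p + 0 + q : ℕ) : ℤ) = j
        · rw [← hj, intProj_of_mem h]
          exact TwoSidedIdeal.mul_mem_right _ _ _ (TwoSidedIdeal.mul_mem_left _ _ _
            (TwoSidedIdeal.subset_span rfl))
        · rw [intProj_of_mem_ne h hj]
          exact zero_mem _
  · rw [map_add]; exact add_mem hx hy
  · rw [map_neg]; exact neg_mem hx

/-- The quotient map by a two-sided ideal, as a linear map. -/
def quotMap (I : TwoSidedIdeal R) : R →ₗ[k] I.ringCon.Quotient where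
  toFun x := I.ringCon.mk' x
  map_add' x y := map_add _ x y
  map_smul' _ _ := rfl

lemma quotMap_eq_iff (I : TwoSidedIdeal R) (x y : R) :
    quotMap (k := k) I x = quotMap (k := k) I y ↔ x - y ∈ I := by
  rw [← TwoSidedIdeal.rel_iff]
  exact RingCon.eq _

lemma quotMap_surjective (I : TwoSidedIdeal R) : Function.Surjective (quotMap (k := k) I) :=
  RingCon.mk'_surjective _

/-- If the quotient by a homogeneous ideal is finite dimensional, then the ideal contains all
components of large degree. -/
lemma exists_le_of_finite_quotient (I : TwoSidedIdeal R)
    (hI : ∀ j, ∀ x ∈ I, intProj 𝒜 j x ∈ I)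
    [Module.Finite k I.ringCon.Quotient] : ∃ n : ℕ, ∀ i, n ≤ i → ∀ x ∈ 𝒜 i, x ∈ I := by
  -- The images of `R_{≥ n}` descend in a finite-dimensional space, so they stabilize. Then `x` of
  -- degree `i ≥ n` is congruent modulo `I` to some `y` with components only in degrees above `i`,
  -- and the component of `x - y` in degree `i` is `x`.
  let V : ℕ →o (Submodule k I.ringCon.Quotient)ᵒᵈ :=
    { toFun := fun n => OrderDual.toDual (Submodule.map (quotMap I) (⨆ i, ⨆ (_ : n ≤ i), 𝒜 i))
      monotone' := fun m n hmn => Submodule.map_mono (iSup_mono fun i =>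
        iSup_le fun h => le_iSup_of_le (hmn.trans h) le_rfl) }
  obtain ⟨n, hn⟩ := IsArtinian.monotone_stabilizes V
  refine ⟨n, fun i hi x hx => ?_⟩
  have hx' : quotMap (k := k) I x ∈
      Submodule.map (quotMap I) (⨆ i', ⨆ (_ : i + 1 ≤ i'), 𝒜 i') := by
    have h1 : (V i).ofDual = (V (i + 1)).ofDual := by rw [← hn i hi, hn (i + 1) (by lia)]
    exact h1.le ⟨x, Submodule.mem_iSup_of_mem i (Submodule.mem_iSup_of_mem le_rfl hx), rfl⟩
  obtain ⟨y, hy, hxy⟩ := hx'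
  have hproj : ∀ z : R, z ∈ (⨆ i', ⨆ (_ : i + 1 ≤ i'), 𝒜 i') →
      intProj 𝒜 i z = 0 := by
    intro z hz
    induction hz using Submodule.iSup_induction' with
    | zero => exact map_zero _
    | add a b _ _ ha hb => rw [map_add, ha, hb, add_zero]
    | mem i' z hz =>
      by_cases h : i + 1 ≤ i'
      · rw [iSup_pos h] at hz
        exact intProj_of_mem_ne hz (by lia)
      · rw [iSup_neg h, Submodule.mem_bot] at hz
        rw [hz, map_zero]
  have h2 := hI i _ ((quotMap_eq_iff I _ _).1 hxy.symm)
  rwa [map_sub, hproj y hy, intProj_of_mem hx, sub_zero] at h2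

lemma finite_quotient_of_le (I : TwoSidedIdeal R) (hfin : ∀ i, (𝒜 i).FG) {n : ℕ}
    (hn : ∀ i, n ≤ i → ∀ x ∈ 𝒜 i, x ∈ I) : Module.Finite k I.ringCon.Quotient := by
  refine ⟨?_⟩
  have h : (⊤ : Submodule k I.ringCon.Quotient) =
      Submodule.map (quotMap I) (⨆ i ∈ Finset.range n, 𝒜 i) := by
    refine (eq_top_iff.2 fun x _ => ?_).symm
    obtain ⟨x, rfl⟩ := quotMap_surjective (k := k) I x
    clear * - hn
    induction x using DirectSum.Decomposition.inductionOn 𝒜 with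
    | zero => rw [map_zero]; exact zero_mem _
    | add x y hx hy => rw [map_add]; exact add_mem hx hy
    | @homogeneous i x =>
      by_cases h : i < n
      · exact ⟨x, Submodule.mem_iSup_of_mem i
          (Submodule.mem_iSup_of_mem (Finset.mem_range.2 h) x.2), rfl⟩
      · have : quotMap (k := k) I (x : R) = quotMap (k := k) I 0 :=
          (quotMap_eq_iff I _ _).2 (by simpa using hn i (by lia) _ x.2)
        rw [this, map_zero]
        exact zero_mem _
  rw [h]
  exact (Submodule.fg_biSup _ _ fun i _ => hfin i).map _

/-- A connected graded right noetherian algebra is locally finite. -/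
lemma fg_of_isConnectedGraded [IsNoetherianRing Rᵐᵒᵖ] (h : IsConnectedGraded 𝒜) (i : ℕ) :
    (𝒜 i).FG := by
  have := finite_op_self R
  -- The right ideal `R_{≥ i}` is finitely generated. Its generators have no component below degree
  -- `i`, so only multiplication by `R_0 = k` contributes to degree `i`, and their components of
  -- degree `i` span `𝒜 i` over `k`.
  let P : Submodule Rᵐᵒᵖ R := (GrMod.regular 𝒜).trunc i
  obtain ⟨T, hT⟩ := IsNoetherian.noetherian P
  let V : Submodule k R := Submodule.span k (intProj 𝒜 i '' (T : Set R))
  have hV : 𝒜 i ≤ V := by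
    intro x hx
    have hxT : x ∈ Submodule.span Rᵐᵒᵖ (T : Set R) :=
      hT.symm ▸ GrMod.mem_trunc_of_mem_deg le_rfl ((GrMod.mem_regular_deg (R := R)).2 hx)
    rw [← intProj_of_mem hx]
    clear hx
    induction hxT using Submodule.closure_induction with
    | zero => rw [map_zero]; exact zero_mem _
    | add a b _ _ ha hb => rw [map_add]; exact add_mem ha hb
    | smul_mem r t ht =>
      induction r using MulOpposite.rec' with
      | _ a =>
      rw [op_smul_eq_mul]
      induction a using DirectSum.Decomposition.inductionOn 𝒜 with
      | zero => rw [mul_zero, map_zero]; exact zero_mem _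
      | add a b ha hb => rw [mul_add, map_add]; exact add_mem ha hb
      | @homogeneous c a =>
        rw [intProj_mul a.2]
        by_cases hc : c = 0
        · subst hc
          obtain ⟨z, hz⟩ := Submodule.mem_one.1 (h.2 ▸ a.2 : (a : R) ∈ (1 : Submodule k R))
          rw [← hz, ← Algebra.commutes, ← Algebra.smul_def, Nat.cast_zero, sub_zero]
          exact V.smul_mem z (Submodule.subset_span ⟨t, ht, rfl⟩)
        · have ht' : t ∈ P := hT ▸ Submodule.subset_span ht
          have h0 : intProj 𝒜 (i - c) t = 0 := ht' (i - c) (by lia)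
          rw [h0, zero_mul]
          exact zero_mem _
  have : Module.Finite k V := Module.Finite.span_of_finite k (T.finite_toSet.image _)
  exact Module.Finite.iff_fg.1 (Submodule.finiteDimensional_of_le hV)

/-- If `q e` lies in `p` in large degrees and `R / (e)` vanishes in large degrees, then `q` lies
in `p` in large degrees. -/
lemma exists_deg_le_of_smul_mem [IsNoetherianRing Rᵐᵒᵖ] {e : R} (he : e ∈ 𝒜 0) {n : ℕ}
    (hn : ∀ i, n ≤ i → ∀ x ∈ 𝒜 i, x ∈ TwoSidedIdeal.span {e})
    (M : grmod 𝒜) (q p : Submodule Rᵐᵒᵖ M.obj.carrier)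
    (hq : ∀ j, ∀ m ∈ q, M.obj.proj j m ∈ q) {d : ℤ}
    (h : ∀ j, d ≤ j → ∀ m ∈ M.obj.deg j, m ∈ q → op e • m ∈ p) :
    ∃ d' : ℤ, ∀ j, d' ≤ j → ∀ m ∈ M.obj.deg j, m ∈ q → m ∈ p := by
  -- Truncating makes the hypothesis hold for all elements of a submodule. Stability under `a` then
  -- gives `x(aeb) = ((xa)e)b ∈ p`, so the truncation is carried into `p` by all of `(e)`.
  have h1 : ∀ x ∈ q ⊓ M.obj.trunc d, op e • x ∈ p := by
    intro x hx
    refine GrMod.mem_of_proj_mem (p := p.toAddSubgroup) fun j => ?_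
    rw [GrMod.proj_smul he, Nat.cast_zero, sub_zero]
    by_cases hj : d ≤ j
    · exact h j hj _ (GrMod.proj_mem j x) (hq j x hx.1)
    · rw [hx.2 j (by lia), smul_zero]
      exact zero_mem _
  have h2 : ∀ r ∈ TwoSidedIdeal.span {e}, ∀ x ∈ q ⊓ M.obj.trunc d, op r • x ∈ p := by
    intro r hr x hx
    refine span_singleton_induction (P := fun r => op r • x ∈ p) hr ?_ (fun a b => ?_)
      (fun r s hr hs => ?_) fun r hr => ?_
    · rw [op_zero, zero_smul]; exact zero_mem _
    · rw [op_mul, op_mul, mul_smul, mul_smul]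
      exact p.smul_mem _ (h1 _ (Submodule.smul_mem _ _ hx))
    · rw [MulOpposite.op_add, add_smul]; exact add_mem hr hs
    · rw [MulOpposite.op_neg, neg_smul]; exact neg_mem hr
  obtain ⟨d', hd'⟩ := GrMod.exists_deg_inf_le_of_torsion (q ⊓ M.obj.trunc d)
    (fun j m hm => ⟨hq j m hm.1, GrMod.proj_mem_trunc d j m hm.2⟩) p.toAddSubgroup
    fun x hx => ⟨n, fun i hi a ha => h2 a (hn i hi a ha) x hx⟩
  exact ⟨max d d', fun j hj m hm hmq =>
    hd' j (by lia) m hm ⟨hmq, GrMod.mem_trunc_of_mem_deg (by lia) hm⟩⟩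

end Ideal

/-! ### The functor `(-)e` and morphisms bijective in large degrees -/

section Main

variable {k : Type v} {A : Type u} [Field k] [Ring A] [Algebra k A]
  {𝒜 : ℕ → Submodule k A} {G : Subgroup (GrAut 𝒜)} [Fintype G]

lemma skewGrading_fg (h : ∀ i, (𝒜 i).FG) (i : ℕ) : (skewGrading G i).FG := by
  have := Module.Finite.iff_fg.2 (h i)
  let f : skewGrading G i →ₗ[k] (G → 𝒜 i) :=
    { toFun := fun x g => ⟨x.1.coeff g, x.2 g⟩
      map_add' := fun x y => funext fun g => Subtype.ext (by simp)
      map_smul' := fun c x => funext fun g => Subtype.ext (by simp) }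
  refine Module.Finite.iff_fg.1 (Module.Finite.of_injective f fun x y hxy => ?_)
  exact Subtype.ext (SkewMonoidAlgebra.ext fun g => congrArg Subtype.val (congrFun hxy g))

/-- Elements of the image are fixed by `e`, so for `x` in the image `(xr)e = x(ere)`, which is `x`
times `corner r` and again lies in the image. -/
lemma exists_eq_avg_smul_of_mem_span {M T : Type u} [AddCommGroup M] [Module (Skew G)ᵐᵒᵖ M]
    [AddCommGroup T] [Module (Inv G)ᵐᵒᵖ T] (τ : T →+ M) (hτ : ∀ t, op (avg G) • τ t = τ t)
    (hs : ∀ (a : Inv G) t, τ (op a • t) = op (invToSkew G a) • τ t) {y : M}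
    (hy : y ∈ Submodule.span (Skew G)ᵐᵒᵖ (Set.range τ)) : ∃ t, τ t = op (avg G) • y := by
  induction hy using Submodule.closure_induction with
  | zero => exact ⟨0, by rw [map_zero, smul_zero]⟩
  | add a b _ _ ha hb =>
    obtain ⟨s, hs⟩ := ha
    obtain ⟨t, ht⟩ := hb
    exact ⟨s + t, by rw [map_add, smul_add, hs, ht]⟩
  | smul_mem r x hx =>
    obtain ⟨t, rfl⟩ := hx
    refine ⟨op (corner r.unop) • t, ?_⟩
    rw [hs]
    conv_lhs => rw [← hτ t]
    conv_rhs => rw [← hτ t, ← op_unop r]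
    rw [← mul_smul, ← mul_smul, ← mul_smul, ← op_mul, ← op_mul, ← op_mul, ← mul_assoc,
      corner_spec, avg_comm]

variable [GradedAlgebra 𝒜]

lemma avg_smul_mem_deg {M : GrMod (skewGrading G)} {j : ℤ} {m : M.carrier} (hm : m ∈ M.deg j) :
    op (avg G) • m ∈ M.deg j := by
  simpa using M.smul_mem (avg_mem G) hm

variable [IsNoetherianRing Aᵐᵒᵖ] (hG : ¬ ringChar k ∣ Fintype.card G)

/-- If `A * G / (e)` vanishes in large degrees, then `(-)e` reflects morphisms which are bijective
in large degrees. -/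
lemma torsIso_of_torsIso_grmodE {n : ℕ}
    (hn : ∀ i, n ≤ i → ∀ x ∈ skewGrading G i, x ∈ TwoSidedIdeal.span {avg G})
    {M N : grmod (skewGrading G)} (f : M ⟶ N)
    (hf : torsIso (invGrading G) ((grmodE G hG).map f)) : torsIso (skewGrading G) f := by
  have := skew_isNoetherianRing G
  have := inv_isNoetherianRing G hG
  obtain ⟨d, hd⟩ := (torsIso_iff _).1 hf
  obtain ⟨d₁, hd₁⟩ := exists_deg_le_of_smul_mem (avg_mem G) hn M (LinearMap.ker f.hom.lin) ⊥
    f.hom.proj_mem_ker (d := d) fun j hj m hm hm0 => by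
      have := (hd j hj).1 ⟨op (avg G) • m, ⟨m, rfl⟩⟩ (avg_smul_mem_deg hm)
        (Subtype.ext ((LinearMap.ker f.hom.lin).smul_mem (op (avg G)) hm0))
      exact congrArg Subtype.val this
  obtain ⟨d₂, hd₂⟩ := exists_deg_le_of_smul_mem (avg_mem G) hn N ⊤ (LinearMap.range f.hom.lin)
    (fun _ _ _ => trivial) (d := d) fun j hj y hy _ => by
      obtain ⟨x, -, hx⟩ := (hd j hj).2 ⟨op (avg G) • y, ⟨y, rfl⟩⟩ (avg_smul_mem_deg hy)
      exact ⟨x.1, congrArg Subtype.val hx⟩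
  refine (torsIso_iff _).2 ⟨max d₁ d₂, fun j hj => ⟨fun m hm h => ?_, fun y hy => ?_⟩⟩
  · exact hd₁ j (by lia) m hm h
  · obtain ⟨x, hx⟩ := hd₂ j (by lia) y hy trivial
    exact ⟨M.obj.proj j x, GrMod.proj_mem j x, by
      rw [f.hom.map_proj, hx, GrMod.proj_of_mem hy]⟩

/-- A morphism `T ⟶ M e` factors through `Z e`, where `Z` is the submodule of `M` generated by its
image, and `T → Z e` is surjective. -/
lemma exists_factor_grmodE {M : grmod (skewGrading G)} {T : grmod (invGrading G)}
    (τ : T ⟶ (grmodE G hG).obj M) :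
    ∃ (Z : grmod (skewGrading G)) (ι : Z ⟶ M) (σ : T ⟶ (grmodE G hG).obj Z),
      σ ≫ (grmodE G hG).map ι = τ ∧ Function.Surjective σ.hom.lin ∧
      Function.Injective ι.hom.lin ∧
      ∀ {Y : grmod (skewGrading G)} (f g : M ⟶ Y),
        τ ≫ (grmodE G hG).map f = τ ≫ (grmodE G hG).map g → ι ≫ f = ι ≫ g := by
  have := skew_isNoetherianRing G
  let τ₀ : T.obj.carrier →+ M.obj.carrier :=
    { toFun := fun t => (τ.hom.lin t).1
      map_zero' := congrArg Subtype.val (map_zero τ.hom.lin)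
      map_add' := fun s t => congrArg Subtype.val (map_add τ.hom.lin s t) }
  have hτ₀ : ∀ t, op (avg G) • τ₀ t = τ₀ t := fun t =>
    avg_smul hG (τ.hom.lin t).2
  have hτ₀s : ∀ (a : Inv G) t, τ₀ (op a • t) = op (invToSkew G a) • τ₀ t := fun a t =>
    congrArg Subtype.val (map_smul τ.hom.lin (op a) t)
  have hτ₀d : ∀ (j : ℤ), ∀ t ∈ T.obj.deg j, τ₀ t ∈ M.obj.deg j := fun j t ht =>
    τ.hom.map_deg j t ht
  let p : Submodule (Skew G)ᵐᵒᵖ M.obj.carrier := Submodule.span _ (Set.range τ₀)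
  have hp : ∀ j, ∀ m ∈ p, M.obj.proj j m ∈ p :=
    GrMod.proj_mem_span_range τ₀ hτ₀d
  let σ₀ : T.obj.carrier → p := fun t => ⟨τ₀ t, Submodule.subset_span ⟨t, rfl⟩⟩
  have hσ₀ : ∀ t, op (avg G) • σ₀ t = σ₀ t := fun t => Subtype.ext (hτ₀ t)
  let σ₁ : T.obj.carrier → mulE G p := fun t => ⟨σ₀ t, ⟨σ₀ t, hσ₀ t⟩⟩
  let σ : T ⟶ (grmodE G hG).obj (grmodSub M p hp) := ObjectProperty.homMk
    { lin :=
        { toFun := σ₁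
          map_add' := fun a b => Subtype.ext (Subtype.ext (map_add τ₀ a b))
          map_smul' := fun a t => Subtype.ext (Subtype.ext (hτ₀s a.unop t)) }
      map_deg := hτ₀d }
  refine ⟨grmodSub M p hp, grmodSubι M p hp, σ, rfl, ?_, Subtype.val_injective, ?_⟩
  · rintro ⟨_, y, rfl⟩
    obtain ⟨t, ht⟩ := exists_eq_avg_smul_of_mem_span τ₀ hτ₀ hτ₀s y.2
    exact ⟨t, Subtype.ext (Subtype.ext ht)⟩
  · intro Y f g h
    refine grmod_hom_ext fun z => ?_
    -- The equalizer of `f` and `g` is an `A * G`-submodule containing the image of `τ`, hence all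
    -- that it generates.
    have hle : p ≤ LinearMap.eqLocus f.hom.lin g.hom.lin := by
      refine Submodule.span_le.2 ?_
      rintro _ ⟨t, rfl⟩
      exact congrArg (fun φ : T ⟶ (grmodE G hG).obj Y =>
        (show mulE G Y.obj.carrier from φ.hom.lin t).1) h
    exact hle z.2

/-- If `A * G / (e)` vanishes in large degrees, then `(-)e` induces an equivalence. -/
lemma tailsE_isEquivalence {n : ℕ}
    (hn : ∀ i, n ≤ i → ∀ x ∈ skewGrading G i, x ∈ TwoSidedIdeal.span {avg G}) :
    (tailsE G hG).IsEquivalence := by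
  have := skew_isNoetherianRing G
  have := inv_isNoetherianRing G hG
  have := torsIso_hasRightCalculusOfFractions (𝒜 := skewGrading G)
  have := torsIso_hasRightCalculusOfFractions (𝒜 := invGrading G)
  let e : grmodE G hG ⋙ (torsIso (invGrading G)).Q ≅ (torsIso (skewGrading G)).Q ⋙ tailsE G hG :=
    (eqToIso (Localization.Construction.fac _ _)).symm
  have h1 : (tailsE G hG).Faithful := by
    refine faithful_of_localization (W := torsIso (skewGrading G)) (W' := torsIso (invGrading G)) e
      fun {X Y} f g {T} s hs h => ?_
    obtain ⟨Z, ι, σ, hσ, -, hι, hfg⟩ := exists_factor_grmodE hG s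
    refine ⟨Z, ι, torsIso_of_torsIso_grmodE hG hn ι ?_, hfg f g h⟩
    obtain ⟨d, hd⟩ := (torsIso_iff s).1 hs
    -- Injectivity comes from `ι`, and surjectivity in large degrees from `s`, which factors through
    -- `Ze`.
    refine (torsIso_iff _).2 ⟨d, fun j hj => ⟨fun z _ hz => ?_, fun y hy => ?_⟩⟩
    · exact Subtype.ext (hι ((congrArg Subtype.val hz).trans (map_zero ι.hom.lin).symm))
    · obtain ⟨t, ht, rfl⟩ := (hd j hj).2 y hy
      exact ⟨σ.hom.lin t, σ.hom.map_deg j t ht, congrArg (fun φ => φ.hom.lin t) hσ⟩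
  have h2 : (tailsE G hG).Full := by
    refine full_of_localization (W := torsIso (skewGrading G)) (W' := torsIso (invGrading G)) e
      fun {X Y T} s g hs => ?_
    -- The pair `(s, g)` generates a submodule `Z` of `X × Y`, whose two projections form the
    -- required roof over `A * G`.
    let τ : T ⟶ (grmodE G hG).obj (grmodProd X Y) := ObjectProperty.homMk
      { lin :=
          { toFun := fun t => ⟨((show mulE G X.obj.carrier from s.hom.lin t).1,
              (show mulE G Y.obj.carrier from g.hom.lin t).1),
              ⟨((show mulE G X.obj.carrier from s.hom.lin t).1,
              (show mulE G Y.obj.carrier from g.hom.lin t).1), Prod.ext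
                (avg_smul hG (show mulE G X.obj.carrier from s.hom.lin t).2)
                (avg_smul hG (show mulE G Y.obj.carrier from g.hom.lin t).2)⟩⟩
            map_add' := fun a b => Subtype.ext (Prod.ext
              (congrArg Subtype.val (map_add s.hom.lin a b))
              (congrArg Subtype.val (map_add g.hom.lin a b)))
            map_smul' := fun a b => Subtype.ext (Prod.ext
              (congrArg Subtype.val (map_smul s.hom.lin a b))
              (congrArg Subtype.val (map_smul g.hom.lin a b))) }
        map_deg := fun j t ht => ⟨s.hom.map_deg j t ht, g.hom.map_deg j t ht⟩ }
    obtain ⟨Z, ι, σ, hσ, hsurj, -, -⟩ := exists_factor_grmodE hG τ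
    have hs' : σ ≫ (grmodE G hG).map (ι ≫ grmodFst X Y) = s := by
      rw [Functor.map_comp, ← Category.assoc, hσ]
      rfl
    have hg' : σ ≫ (grmodE G hG).map (ι ≫ grmodSnd X Y) = g := by
      rw [Functor.map_comp, ← Category.assoc, hσ]
      rfl
    obtain ⟨d, hd⟩ := (torsIso_iff s).1 hs
    have hsσ : ∀ t, s.hom.lin t =
        ((grmodE G hG).map (ι ≫ grmodFst X Y)).hom.lin (σ.hom.lin t) := fun t =>
      (congrArg (fun φ => φ.hom.lin t) hs').symm
    have hlift : ∀ (j : ℤ), ∀ z ∈ ((grmodE G hG).obj Z).obj.deg j, ∃ t ∈ T.obj.deg j,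
        σ.hom.lin t = z := fun j z hz => by
      obtain ⟨t, rfl⟩ := hsurj z
      exact ⟨T.obj.proj j t, GrMod.proj_mem j t, by
        rw [σ.hom.map_proj, GrMod.proj_of_mem hz]⟩
    refine ⟨Z, ι ≫ grmodFst X Y, ι ≫ grmodSnd X Y, σ,
      torsIso_of_torsIso_grmodE hG hn _ ?_, ?_, hs', hg'⟩
    · refine (torsIso_iff _).2 ⟨d, fun j hj => ⟨fun z hz hz0 => ?_, fun y hy => ?_⟩⟩
      · obtain ⟨t, ht, rfl⟩ := hlift j z hz
        rw [(hd j hj).1 t ht ((hsσ t).trans hz0), map_zero]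
      · obtain ⟨t, ht, rfl⟩ := (hd j hj).2 y hy
        exact ⟨σ.hom.lin t, σ.hom.map_deg j t ht, (hsσ t).symm⟩
    · refine (torsIso_iff _).2 ⟨d, fun j hj => ⟨fun t ht ht0 => ?_, hlift j⟩⟩
      exact (hd j hj).1 t ht (by rw [hsσ, ht0, map_zero])
  have h3 : (tailsE G hG).EssSurj := by
    refine essSurj_of_localization (W' := torsIso (invGrading G)) e fun N => ?_
    let M : grmod (skewGrading G) := ⟨grExtension hG N.obj, by
      have : Module.Finite (Skew G)ᵐᵒᵖ (grExtension hG N.obj).carrier :=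
        extension_finite hG (N := N.obj.carrier)
      exact Module.finitePresentation_of_finite _ _⟩
    let f : N ⟶ (grmodE G hG).obj M := ObjectProperty.homMk (unitExtension hG N.obj)
    have hf : Function.Bijective f.hom.lin := unitExtension_bijective hG N.obj
    refine ⟨M, f, (torsIso_iff _).2 ⟨0, fun j _ => ⟨fun m _ hm => ?_, fun y hy => ?_⟩⟩⟩
    · exact hf.1 (hm.trans (map_zero _).symm)
    · obtain ⟨x, rfl⟩ := hf.2 y
      exact ⟨N.obj.proj j x, GrMod.proj_mem j x, by
        rw [f.hom.map_proj, GrMod.proj_of_mem hy]⟩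
  exact { }

/-- If `(-)e` induces an equivalence, then `A * G / (e)` vanishes in large degrees. -/
lemma exists_le_of_tailsE_isEquivalence [(tailsE G hG).IsEquivalence] :
    ∃ n : ℕ, ∀ i, n ≤ i → ∀ x ∈ skewGrading G i, x ∈ TwoSidedIdeal.span {avg G} := by
  have := skew_isNoetherianRing G
  have := inv_isNoetherianRing G hG
  have := torsIso_hasRightCalculusOfFractions (𝒜 := skewGrading G)
  let e : grmodE G hG ⋙ (torsIso (invGrading G)).Q ≅ (torsIso (skewGrading G)).Q ⋙ tailsE G hG :=
    (eqToIso (Localization.Construction.fac _ _)).symm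
  let M : grmod (skewGrading G) := ⟨GrMod.regular (skewGrading G), by
    have := finite_op_self (Skew G)
    exact Module.finitePresentation_of_finite (Skew G)ᵐᵒᵖ (Skew G)⟩
  let I : TwoSidedIdeal (Skew G) := TwoSidedIdeal.span {avg G}
  let p : Submodule (Skew G)ᵐᵒᵖ M.obj.carrier := rightIdeal I
  let ι := grmodSubι M p (intProj_mem_span_singleton (avg_mem G))
  -- Every `xe` already lies in `(e)`, so the inclusion is bijective on `e`-parts in all degrees.
  have hι : torsIso (invGrading G) ((grmodE G hG).map ι) := by
    refine (torsIso_iff _).2 ⟨0, fun j _ => ⟨fun z _ hz => ?_, fun y hy => ?_⟩⟩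
    · exact Subtype.ext (Subtype.ext (congrArg (fun w : mulE G M.obj.carrier => w.1) hz))
    · have hyp : y.1 ∈ p := by
        obtain ⟨x, hx⟩ := y.2
        rw [← hx]
        exact I.mul_mem_left (x : Skew G) (avg G) (TwoSidedIdeal.subset_span rfl)
      exact ⟨⟨⟨y.1, hyp⟩, ⟨⟨y.1, hyp⟩, Subtype.ext (avg_smul hG y.2)⟩⟩, hy, rfl⟩
  have : IsIso ((torsIso (invGrading G)).Q.map ((grmodE G hG).map ι)) :=
    Localization.inverts _ _ _ hι
  have : IsIso ((tailsE G hG).map ((torsIso (skewGrading G)).Q.map ι)) :=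
    (NatIso.isIso_map_iff e ι).1 this
  have : IsIso ((torsIso (skewGrading G)).Q.map ι) := isIso_of_reflects_iso _ (tailsE G hG)
  -- The calculus of fractions only places some `g ≫ ι` in the localizing class; its surjectivity in
  -- large degrees suffices, since its image lies in `(e)`.
  obtain ⟨Z, g, hg⟩ := exists_comp_mem_of_isIso (L := (torsIso (skewGrading G)).Q)
    (W := torsIso (skewGrading G)) ι
  obtain ⟨d, hd⟩ := (torsIso_iff _).1 hg
  refine ⟨d.toNat, fun i hi x hx => ?_⟩
  obtain ⟨z, -, hz⟩ := (hd i (by lia)).2 x ((GrMod.mem_regular_deg (R := Skew G)).2 hx)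
  rw [← hz]
  exact (show p from g.hom.lin z).2

end Main

end NCProj

theorem mainTheorem7 {k : Type v} [Field k] [IsAlgClosed k] {A : Type u} [Ring A] [Algebra k A]
    (𝒜 : ℕ → Submodule k A) [GradedAlgebra 𝒜] (hconn : NCProj.IsConnectedGraded 𝒜)
    [IsNoetherianRing Aᵐᵒᵖ] (G : Subgroup (NCProj.GrAut 𝒜)) [Fintype G]
    (hG : ¬ ringChar k ∣ Fintype.card G) :
    Module.Finite k (TwoSidedIdeal.span {NCProj.avg G}).ringCon.Quotient ↔
      (NCProj.tailsE G hG).IsEquivalence := by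
  constructor
  · intro h
    obtain ⟨n, hn⟩ := NCProj.exists_le_of_finite_quotient (𝒜 := NCProj.skewGrading G) _
      (NCProj.intProj_mem_span_singleton (NCProj.avg_mem G))
    exact NCProj.tailsE_isEquivalence hG hn
  · intro h
    obtain ⟨n, hn⟩ := NCProj.exists_le_of_tailsE_isEquivalence hG
    -- Connectedness enters here: it makes each `A_i`, hence each `(A * G)_i`, finite dimensional,
    -- and finitely many of these span the quotient.
    exact NCProj.finite_quotient_of_le _
      (NCProj.skewGrading_fg (NCProj.fg_of_isConnectedGraded hconn)) hn
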